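/- Let $d\ge 3$, $p\in(d,\infty)$, $\mathbf H\in L^p_{loc}(\mathbb R^d,\mathbb R^d)$, and let $A=(a_{ij})_{1\le i,j\le d}$ be a (possibly non-symmetric) matrix of functions on $\mathbb R^d$ such that, for some constants $\lambda,M>0$, $$\lambda\|\xi\|^2\le\langle A(x)\xi,\xi\rangle,\qquad \max_{i,j}|a_{ij}(x)|\le M\qquad\text{for a.e. }x\in\mathbb R^d\text{ and all }\xi\in\mathbb R^d,$$ and such that each $a_{ij}$ is in $VMO$, i.e. $a_{ij}\in L^1_{loc}(\mathbb R^d)$ and there is a continuous $\omega:[0,\infty)\to\mathbb R$ with $\omega(0)=0$ and $\omega>0$ on $(0,\infty)$ for which $$\sup_{z\in\mathbb R^d,\,r<R}r^{-2d}\int_{B_r(z)}\int_{B_r(z)}|a_{ij}(x)-a_{ij}(y)|\,dx\,dy\le\omega(R)\qquad\text{for all }R>0.$$ Let $\rho\in H^{1,p}_{loc}(\mathbb R^d)\cap C(\mathbb R^d)$ be strictly positive everywhere with $$\int_{\mathbb R^d}\langle A^T\nabla\rho-\rho\mathbf H,\nabla\varphi\rangle\,dx=0\qquad\text{for all }\varphi\in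 C_0^\infty(\mathbb R^d),$$ and put $\mu:=\rho\,dx$ and $\mathbf B:=\mathbf H-\rho^{-1}A^T\nabla\rho$. Let $B\subset\mathbb R^d$ be an open ball (of positive radius) and $$\mathcal E^B(f,g):=\int_B\langle A\nabla f,\nabla g\rangle\,d\mu-\int_B\langle\mathbf B,\nabla f\rangle\,g\,d\mu,\qquad f,g\in C_0^\infty(B).$$ Then both integrands are $\mu$-integrable on $B$, $\mathcal E^B$ is a bilinear form on $C_0^\infty(B)$ with $\mathcal E^B(f,f)\ge0$ for all $f$, and the following hold. (i) $(\mathcal E^B,C_0^\infty(B))$ satisfies the strong sector condition: there is a constant $c>0$ such that $|\mathcal E^B(f,g)|\le c\,\mathcal E^B(f,f)^{1/2}\mathcal E^B(g,g)^{1/2}$ for all $f,g\in C_0^\infty(B)$. (ii) $(\mathcal E^B,C_0^\infty(B))$ is closable on $L^2(B,\mu)$: if $f_n\in C_0^\infty(B)$, $f_n\to0$ in $L^2(B,\mu)$ and $\mathcal E^B(f_n-f_m,f_n-f_m)\to0$ as $n,m\to\infty$, then $\mathcal E^B(f_n,f_n)\to0$. Its closure $(\mathcal E^B,D(\mathcal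 E^B))$ has as domain the set of all $L^2(B,\mu)$-limits of sequences $(f_n)\subset C_0^\infty(B)$ with $\mathcal E^B(f_n-f_m,f_n-f_m)\to0$, and $\mathcal E^B(f,g)=\lim_n\mathcal E^B(f_n,g_n)$ for any such sequences $f_n\to f$, $g_n\to g$. It is a coercive closed form on $L^2(B,\mu)$, i.e. a densely defined bilinear form with $\mathcal E^B(f,f)\ge0$ whose domain is complete with respect to $\mathcal E^B_1(f,f)^{1/2}$, where $\mathcal E^B_1(f,g):=\mathcal E^B(f,g)+(f,g)_{L^2(B,\mu)}$, and which satisfies the weak sector condition $|\mathcal E_1^B(f,g)|\le K\,\mathcal E_1^B(f,f)^{1/2}\mathcal E_1^B(g,g)^{1/2}$ for some constant $K>0$. It is the smallest coercive closed form on $L^2(B,\mu)$ extending $(\mathcal E^B,C_0^\infty(B))$. (iii) $D(\mathcal E^B)=H^{1,2}_0(B)$, the closure of $C_0^\infty(B)$ in $H^{1,2}(B)$, and with weak gradients $$\mathcal E^B(f,g)=\int_B\langle A\nabla f,\nabla g\rangle\,d\mu-\int_B\langle\mathbf B,\nabla f\rangle\,g\,d\mu\qquad\text{for all }f,g\in D(\mathcal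 E^B),$$ both integrands being $\mu$-integrable on $B$. In particular $\mathcal E^B(f,f)=\int_B\langle A\nabla f,\nabla f\rangle\,d\mu$ for all $f\in D(\mathcal E^B)$. (iv) $(\mathcal E^B,D(\mathcal E^B))$ is a Dirichlet form: for every $u\in D(\mathcal E^B)$ the function $v:=u^+\wedge1$ lies in $D(\mathcal E^B)$, and $\mathcal E^B(u+v,u-v)\ge0$ and $\mathcal E^B(u-v,u+v)\ge0$. -/

import Mathlib

open MeasureTheory Filter Topology Set
open scoped ContDiff ENNReal Matrix

/-- The Euclidean space `ℝ^d`. -/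
abbrev Rn (d : ℕ) : Type := EuclideanSpace ℝ (Fin d)

noncomputable section

/-! ### Function spaces on open subsets of `ℝ^d` -/

/-- `f ∈ C₀^∞(U)`: smooth on `ℝ^d`, with compact support contained in `U`. -/
structure IsTest {d : ℕ} (U : Set (Rn d)) (f : Rn d → ℝ) : Prop where
  smooth : ContDiff ℝ ∞ f
  compact : HasCompactSupport f
  supp : tsupport f ⊆ U

/-- `f ∈ L^q_loc(ℝ^d)` (scalar or vector valued): `f ∈ L^q(W)` for every bounded open `W`. -/
def MemLpLoc {d : ℕ} {F : Type*} [NormedAddCommGroup F] (f : Rn d → F) (q : ℝ≥0∞) : Prop :=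
  ∀ W : Set (Rn d), IsOpen W → Bornology.IsBounded W → MemLp f q (volume.restrict W)

/-- `G` is (a version of) the weak gradient of `f` on the open set `U`. -/
structure HasWeakGradient {d : ℕ} (U : Set (Rn d)) (f : Rn d → ℝ) (G : Rn d → Rn d) : Prop where
  locInt : LocallyIntegrableOn f U volume
  locIntGrad : LocallyIntegrableOn G U volume
  integral_eq : ∀ φ : Rn d → ℝ, IsTest U φ → ∀ i : Fin d,
    ∫ x in U, f x * gradient φ x i = - ∫ x in U, G x i * φ x

/-- `f ∈ H₀^{1,2}(U)`: `f` and its weak gradient are square integrable on `U`, and `f` is a limit of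
functions in `C₀^∞(U)` in the norm of `H^{1,2}(U)`. -/
def MemH10 {d : ℕ} (U : Set (Rn d)) (f : Rn d → ℝ) : Prop :=
  ∃ G : Rn d → Rn d, HasWeakGradient U f G ∧
    MemLp f 2 (volume.restrict U) ∧ MemLp G 2 (volume.restrict U) ∧
    ∃ φ : ℕ → Rn d → ℝ, (∀ n, IsTest U (φ n)) ∧
      Tendsto (fun n => eLpNorm (fun x => f x - φ n x) 2 (volume.restrict U)) atTop (𝓝 0) ∧
      Tendsto (fun n => eLpNorm (fun x => G x - gradient (φ n) x) 2 (volume.restrict U))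
        atTop (𝓝 0)

/-- The class `VMO` on `ℝ^d`: locally integrable functions whose mean oscillation over balls of
radius less than `R` is dominated by a modulus `w(R)`, where `w` is continuous on `[0, ∞)`,
vanishes at `0` and is positive on `(0, ∞)`. -/
def MemVMO {d : ℕ} (g : Rn d → ℝ) : Prop :=
  LocallyIntegrable g volume ∧
  ∃ w : ℝ → ℝ, ContinuousOn w (Ici 0) ∧ w 0 = 0 ∧ (∀ t, 0 < t → 0 < w t) ∧
    ∀ R, 0 < R → ∀ (z : Rn d) (r : ℝ), 0 < r → r < R →
      (r ^ (2 * d))⁻¹ * ∫ x in Metric.ball z r, ∫ y in Metric.ball z r, |g x - g y| ≤ w R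

/-! ### Coefficients, the density and the form on test functions -/

/-- The matrix `M` applied to a vector of `ℝ^d`. -/
def matVec {d : ℕ} (M : Matrix (Fin d) (Fin d) ℝ) (ξ : Rn d) : Rn d :=
  WithLp.toLp 2 (M *ᵥ (ξ : Fin d → ℝ))

/-- The standing hypothesis on the coefficients: `d ≥ 3`, `H ∈ L^p_loc(ℝ^d, ℝ^d)` for some
`p ∈ (d, ∞)`, and `A` is a matrix of `VMO` functions, uniformly elliptic and bounded on `ℝ^d`. -/
structure HypCoeff {d : ℕ} (A : Rn d → Matrix (Fin d) (Fin d) ℝ) (H : Rn d → Rn d) (p : ℝ) :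
    Prop where
  three_le : 3 ≤ d
  lt_p : (d : ℝ) < p
  drift : MemLpLoc H (ENNReal.ofReal p)
  vmo : ∀ i j, MemVMO (fun x => A x i j)
  elliptic_bounded : ∃ lam M : ℝ, 0 < lam ∧ 0 < M ∧ ∀ᵐ x ∂(volume : Measure (Rn d)),
    (∀ ξ : Rn d, lam * ‖ξ‖ ^ 2 ≤ inner ℝ (matVec (A x) ξ) ξ) ∧ ∀ i j, |A x i j| ≤ M

/-- `ρ ∈ H^{1,p}_loc(ℝ^d) ∩ C(ℝ^d)` is strictly positive, `Dρ` is its weak gradient, and `ρ dx` is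
infinitesimally invariant for `f ↦ div(A∇f) + ⟨H, ∇f⟩` on `C₀^∞(ℝ^d)`, in the weak form
`∫ ⟨Aᵀ∇ρ - ρH, ∇φ⟩ dx = 0` for all test functions `φ`. -/
structure IsInvariantDensity {d : ℕ} (A : Rn d → Matrix (Fin d) (Fin d) ℝ) (H : Rn d → Rn d)
    (p : ℝ) (ρ : Rn d → ℝ) (Dρ : Rn d → Rn d) : Prop where
  cont : Continuous ρ
  pos : ∀ x, 0 < ρ x
  memLpLoc : MemLpLoc ρ (ENNReal.ofReal p)
  weakGradient : HasWeakGradient univ ρ Dρ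
  memLpLoc_grad : MemLpLoc Dρ (ENNReal.ofReal p)
  invariant : ∀ φ : Rn d → ℝ, IsTest univ φ →
    ∫ x, inner ℝ (matVec (A x)ᵀ (Dρ x) - ρ x • H x) (gradient φ x) = 0

/-- `μ = ρ dx`. -/
def refMeasure {d : ℕ} (ρ : Rn d → ℝ) : Measure (Rn d) :=
  volume.withDensity (fun x => ENNReal.ofReal (ρ x))

/-- The vector field `H - ρ⁻¹ Aᵀ∇ρ`. -/
def driftB {d : ℕ} (A : Rn d → Matrix (Fin d) (Fin d) ℝ) (H : Rn d → Rn d)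
    (ρ : Rn d → ℝ) (Dρ : Rn d → Rn d) (x : Rn d) : Rn d :=
  H x - (ρ x)⁻¹ • matVec (A x)ᵀ (Dρ x)

/-- `∫_U ⟨A F, G⟩ dμ - ∫_U ⟨b, F⟩ g dμ`, to be used with `F = ∇f` and `G = ∇g`. -/
def energy {d : ℕ} (μ : Measure (Rn d)) (U : Set (Rn d)) (A : Rn d → Matrix (Fin d) (Fin d) ℝ)
    (b F : Rn d → Rn d) (g : Rn d → ℝ) (G : Rn d → Rn d) : ℝ :=
  (∫ x in U, inner ℝ (matVec (A x) (F x)) (G x) ∂μ) - ∫ x in U, inner ℝ (b x) (F x) * g x ∂μ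

/-- Both integrands in `energy` are integrable. -/
def EnergyIntegrable {d : ℕ} (μ : Measure (Rn d)) (U : Set (Rn d))
    (A : Rn d → Matrix (Fin d) (Fin d) ℝ)
    (b F : Rn d → Rn d) (g : Rn d → ℝ) (G : Rn d → Rn d) : Prop :=
  IntegrableOn (fun x => inner ℝ (matVec (A x) (F x)) (G x)) U μ ∧
    IntegrableOn (fun x => inner ℝ (b x) (F x) * g x) U μ

/-- The form `𝓔(f, g) = ∫_U ⟨A∇f, ∇g⟩ dμ - ∫_U ⟨b, ∇f⟩ g dμ` on test functions. -/
def testEnergy {d : ℕ} (μ : Measure (Rn d)) (U : Set (Rn d))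
    (A : Rn d → Matrix (Fin d) (Fin d) ℝ) (b : Rn d → Rn d) (f g : Rn d → ℝ) : ℝ :=
  energy μ U A b (gradient f) g (gradient g)

/-! ### Forms on a real Hilbert space -/

/-- A real function of two variables from a linear subspace `dom` of a real Hilbert space `H`;
only the values of `form` on `dom × dom` are relevant. -/
structure DomForm (H : Type*) [NormedAddCommGroup H] [InnerProductSpace ℝ H] where
  dom : Submodule ℝ H
  form : H → H → ℝ

namespace DomForm

variable {H : Type*} [NormedAddCommGroup H] [InnerProductSpace ℝ H]

/-- `E` is bilinear on its domain. -/
def IsBilinear (E : DomForm H) : Prop :=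
  (∀ u ∈ E.dom, ∀ v ∈ E.dom, ∀ w ∈ E.dom, ∀ a : ℝ,
    E.form (a • u + v) w = a * E.form u w + E.form v w) ∧
  (∀ u ∈ E.dom, ∀ v ∈ E.dom, ∀ w ∈ E.dom, ∀ a : ℝ,
    E.form w (a • u + v) = a * E.form w u + E.form w v)

/-- `E(u, u) ≥ 0` on the domain. -/
def IsPositive (E : DomForm H) : Prop := ∀ u ∈ E.dom, 0 ≤ E.form u u

/-- `E₁(u, v) = E(u, v) + (u, v)_H`. -/
def form₁ (E : DomForm H) (u v : H) : ℝ := E.form u v + inner ℝ u v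

/-- The weak sector condition. -/
def WeakSector (E : DomForm H) : Prop :=
  ∃ K : ℝ, 0 < K ∧ ∀ u ∈ E.dom, ∀ v ∈ E.dom,
    |E.form₁ u v| ≤ K * Real.sqrt (E.form₁ u u) * Real.sqrt (E.form₁ v v)

/-- `(u n)` is a sequence in the domain with `E(u n - u m, u n - u m) → 0`. -/
def IsCauchy (E : DomForm H) (u : ℕ → H) : Prop :=
  (∀ n, u n ∈ E.dom) ∧
    Tendsto (fun k : ℕ × ℕ => E.form (u k.1 - u k.2) (u k.1 - u k.2)) atTop (𝓝 0)

/-- Closability on `H` of a positive bilinear form satisfying the weak sector condition. -/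
structure IsClosable (E : DomForm H) : Prop where
  bilinear : E.IsBilinear
  positive : E.IsPositive
  weakSector : E.WeakSector
  closable : ∀ u : ℕ → H, E.IsCauchy u → Tendsto u atTop (𝓝 0) →
    Tendsto (fun n => E.form (u n) (u n)) atTop (𝓝 0)

/-- Coercive closed forms on `H`: densely defined, bilinear, positive, with domain complete for the
norm `E₁(u, u)^{1/2}`, and satisfying the weak sector condition. -/
structure IsCoerciveClosed (E : DomForm H) : Prop where
  dense : Dense (E.dom : Set H)
  bilinear : E.IsBilinear
  positive : E.IsPositive
  complete : ∀ u : ℕ → H, (∀ n, u n ∈ E.dom) →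
    Tendsto (fun k : ℕ × ℕ => E.form₁ (u k.1 - u k.2) (u k.1 - u k.2)) atTop (𝓝 0) →
    ∃ v ∈ E.dom, Tendsto (fun n => E.form₁ (u n - v) (u n - v)) atTop (𝓝 0)
  weakSector : E.WeakSector

/-- `F` is an extension of `E`. -/
def Extends (F E : DomForm H) : Prop :=
  E.dom ≤ F.dom ∧ ∀ u ∈ E.dom, ∀ v ∈ E.dom, F.form u v = E.form u v

/-- `F` is the closure of `E` on `H`: its domain consists of the limits in `H` of the `E`-Cauchy
sequences, and `F(u, v) = lim E(u n, v n)` along any such sequences. -/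
def IsClosureOf (F E : DomForm H) : Prop :=
  (∀ u : H, u ∈ F.dom ↔ ∃ s : ℕ → H, E.IsCauchy s ∧ Tendsto s atTop (𝓝 u)) ∧
  ∀ (u v : H) (s t : ℕ → H), E.IsCauchy s → Tendsto s atTop (𝓝 u) →
    E.IsCauchy t → Tendsto t atTop (𝓝 v) →
    Tendsto (fun n => E.form (s n) (t n)) atTop (𝓝 (F.form u v))

/-- `F` is the smallest coercive closed form on `H` extending `E`. -/
def IsSmallestCoerciveClosedExtension (F E : DomForm H) : Prop :=
  F.IsCoerciveClosed ∧ F.Extends E ∧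
    ∀ F' : DomForm H, F'.IsCoerciveClosed → F'.Extends E → F'.Extends F

/-- (Non-symmetric) Dirichlet forms on `L²(m)`: coercive closed forms such that, for each `u` in the
domain, `v = u⁺ ∧ 1` lies in the domain, `E(u + v, u - v) ≥ 0` and `E(u - v, u + v) ≥ 0`. -/
def IsDirichlet {X : Type*} [MeasurableSpace X] {m : Measure X} (E : DomForm (Lp ℝ 2 m)) : Prop :=
  E.IsCoerciveClosed ∧
    ∀ u ∈ E.dom, ∃ v ∈ E.dom, (v =ᵐ[m] fun x => min (max (u x) 0) 1) ∧
      0 ≤ E.form (u + v) (u - v) ∧ 0 ≤ E.form (u - v) (u + v)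

end DomForm

/-! ### The form on `C₀^∞(U)`, viewed as a subspace of `L²(U, μ)` -/

theorem IsTest.zero {d : ℕ} (U : Set (Rn d)) : IsTest U (0 : Rn d → ℝ) :=
  ⟨contDiff_const, HasCompactSupport.zero, by simp [tsupport]⟩

theorem IsTest.add {d : ℕ} {U : Set (Rn d)} {f g : Rn d → ℝ} (hf : IsTest U f) (hg : IsTest U g) :
    IsTest U (f + g) :=
  ⟨hf.smooth.add hg.smooth, hf.compact.add hg.compact,
    (tsupport_add f g).trans (union_subset hf.supp hg.supp)⟩

theorem IsTest.smul {d : ℕ} {U : Set (Rn d)} {f : Rn d → ℝ} (a : ℝ) (hf : IsTest U f) :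
    IsTest U (a • f) :=
  ⟨hf.smooth.const_smul a, hf.compact.smul_left (f := fun _ => a),
    (closure_mono (Function.support_const_smul_subset a f)).trans hf.supp⟩

/-- `C₀^∞(U)` as a linear subspace of `L²(U, μ)`. -/
def testSubmodule {d : ℕ} (μ : Measure (Rn d)) (U : Set (Rn d)) :
    Submodule ℝ (Lp ℝ 2 (μ.restrict U)) where
  carrier := {u | ∃ f : Rn d → ℝ, IsTest U f ∧ u =ᵐ[μ.restrict U] f}
  zero_mem' := ⟨0, IsTest.zero U, Lp.coeFn_zero ℝ 2 _⟩
  add_mem' := by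
    rintro u v ⟨f, hf, huf⟩ ⟨g, hg, hvg⟩
    exact ⟨f + g, hf.add hg, (Lp.coeFn_add u v).trans (huf.add hvg)⟩
  smul_mem' := by
    rintro a u ⟨f, hf, huf⟩
    exact ⟨a • f, hf.smul a, (Lp.coeFn_smul a u).trans (huf.const_smul a)⟩

open Classical in
/-- The representative in `C₀^∞(U)` of a class in `L²(U, μ)`, if there is one. -/
def testRep {d : ℕ} (μ : Measure (Rn d)) (U : Set (Rn d)) (u : Lp ℝ 2 (μ.restrict U)) :
    Rn d → ℝ :=
  if h : ∃ f : Rn d → ℝ, IsTest U f ∧ u =ᵐ[μ.restrict U] f then h.choose else 0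

/-- The form `testEnergy` with domain `C₀^∞(U) ⊆ L²(U, μ)`. -/
def testForm {d : ℕ} (μ : Measure (Rn d)) (U : Set (Rn d))
    (A : Rn d → Matrix (Fin d) (Fin d) ℝ) (b : Rn d → Rn d) : DomForm (Lp ℝ 2 (μ.restrict U)) where
  dom := testSubmodule μ U
  form u v := testEnergy μ U A b (testRep μ U u) (testRep μ U v)

/-- For a positive continuous density, a class in `L²(U, ρ dx)` has at most one representative in
`C₀^∞(U)`, so `testForm` does not depend on a choice. -/
theorem testRep_eq {d : ℕ} {ρ : Rn d → ℝ} (hc : Continuous ρ) (hpos : ∀ x, 0 < ρ x)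
    {U : Set (Rn d)} (hU : IsOpen U) {u : Lp ℝ 2 ((refMeasure ρ).restrict U)} {f : Rn d → ℝ}
    (hf : IsTest U f) (huf : u =ᵐ[(refMeasure ρ).restrict U] f) :
    testRep (refMeasure ρ) U u = f := by
  have h : ∃ f : Rn d → ℝ, IsTest U f ∧ u =ᵐ[(refMeasure ρ).restrict U] f := ⟨f, hf, huf⟩
  rw [testRep, dif_pos h]
  obtain ⟨hg, hug⟩ := h.choose_spec
  set g := h.choose
  have hae : g =ᵐ[(refMeasure ρ).restrict U] f := hug.symm.trans huf
  have hac : (volume : Measure (Rn d)) ≪ refMeasure ρ :=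
    withDensity_absolutelyContinuous' hc.measurable.ennreal_ofReal.aemeasurable
      (Eventually.of_forall fun x => by simpa using hpos x)
  have hae' : g =ᵐ[volume.restrict U] f := (hac.restrict U).ae_le hae
  have hon : EqOn g f U :=
    Measure.eqOn_open_of_ae_eq hae' hU hg.smooth.continuous.continuousOn
      hf.smooth.continuous.continuousOn
  funext x
  by_cases hx : x ∈ U
  · exact hon hx
  · rw [image_eq_zero_of_notMem_tsupport fun h' => hx (hg.supp h'),
      image_eq_zero_of_notMem_tsupport fun h' => hx (hf.supp h')]

end

/-! On the bounded set `B` the continuous positive density `ρ` lies between two positive constants,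
so `L^q(B, μ)` and `L^q(B, dx)` agree with equivalent norms, and Sobolev estimates for Lebesgue
measure carry over to `μ`.

Two facts control the drift `b = H - ρ⁻¹ Aᵀ∇ρ`. First, `b` lies in `L^p(B)`, hence in `L^d(B)`.
Hölder's inequality and the Sobolev embedding `H₀^{1,2} ⊆ L^{2d/(d-2)}` give `‖g b‖₂ ≤ C ‖∇g‖₂`
(`exists_drift_bound`), so the drift part `N(f, g) = ∫ ⟨b, ∇f⟩ g dμ` is bounded by `C ‖∇f‖₂ ‖∇g‖₂`,
as is the diffusion part `P(f, g) = ∫ ⟨A∇f, ∇g⟩ dμ`. Second, `ρ b` is divergence free. Testing the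
invariance of `ρ dx` with `Φ ∘ f`, where `Φ' = φ`, gives `∫ ⟨b, ∇f⟩ φ(f) dμ = 0`
(`setIntegral_driftB_comp`). In particular `N(f, f) = 0`, so ellipticity gives `𝓔(f, f) = P(f, f) ≥
λ ‖∇f‖₂²`. Boundedness and coercivity in the same seminorm `‖∇f‖₂` yield the strong sector
condition.

For the closure, let `W` be the closure of the pairs `(f, ∇f)` in `L²(μ) × L²(μ; ℝ^d)`. Weak
gradients are unique, so an element of `W` is determined by its first component (`h10Pairs_graph`);
this is closability. The form extends continuously to `W`, and the closure is this extension read on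
the projection of `W` to `L²`, which is `H₀^{1,2}(B)` (`memH10_iff`). That part is abstract
(`IsGraphForm`, `IsGraphForm.IsCore`). Minimality holds because any coercive closed extension is
complete and so contains the limits of all form-Cauchy sequences.

For the Dirichlet property put `v = u⁺ ∧ 1`, so `∇v = χ ∇u` with `χ` the indicator of `{0 < u < 1}`.
Smooth approximations of the contraction and `N(f, φ(f)) = 0` give `N(u, v) = 0`. Since `N` vanishes
on the diagonal it is antisymmetric, so `N` contributes nothing to `𝓔(u ± v, u ∓ v)`. What remains
is `∫ (1 + χ)(1 - χ) ⟨A∇u, ∇u⟩ dμ ≥ 0`. -/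

noncomputable section

/-! ### Forms on the closure of a graph -/

section GraphForm

variable {H K : Type*} [NormedAddCommGroup H] [InnerProductSpace ℝ H]
  [NormedAddCommGroup K] [NormedSpace ℝ K]

open Classical in
/-- The element of `W` with first component `u`, if there is one. -/
def graphLift (W : Submodule ℝ (H × K)) (u : H) : W :=
  if h : ∃ w : W, w.1.1 = u then h.choose else 0

/-- The form on the projection of `W` to `H` induced by a bilinear form on `W`. -/
def graphForm (W : Submodule ℝ (H × K)) (a : W →L[ℝ] W →L[ℝ] ℝ) : DomForm H where
  dom := W.map (LinearMap.fst ℝ H K)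
  form u v := a (graphLift W u) (graphLift W v)

/-- `W` is the graph of an operator with values in `K`, and `a` is bounded and coercive with respect
to the seminorm given by the second component. -/
structure IsGraphForm (W : Submodule ℝ (H × K)) (a : W →L[ℝ] W →L[ℝ] ℝ) : Prop where
  graph : ∀ w : W, w.1.1 = 0 → w = 0
  bound : ∃ C : ℝ, 0 < C ∧ ∀ w z : W, |a w z| ≤ C * ‖w.1.2‖ * ‖z.1.2‖
  coercive : ∃ c : ℝ, 0 < c ∧ ∀ w : W, c * ‖w.1.2‖ ^ 2 ≤ a w w

namespace IsGraphForm

variable {W T : Submodule ℝ (H × K)} {a : W →L[ℝ] W →L[ℝ] ℝ}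

/-- Two elements of `W` over the same point of `H` differ by one with first component `0`, which
vanishes by `graph`. Hence the form does not depend on the choice made in `graphLift`. -/
theorem lift_eq (h : IsGraphForm W a) (w : W) : graphLift W w.1.1 = w := by
  have hex : ∃ z : W, z.1.1 = w.1.1 := ⟨w, rfl⟩
  have := hex.choose_spec
  rw [graphLift, dif_pos hex, ← sub_eq_zero]
  exact h.graph _ (by simp [this])

theorem form_eq (h : IsGraphForm W a) (w z : W) : (graphForm W a).form w.1.1 z.1.1 = a w z := by
  simp only [graphForm, h.lift_eq]

theorem form_add_sub (h : IsGraphForm W a) (w z : W) :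
    (graphForm W a).form (w.1.1 + z.1.1) (w.1.1 - z.1.1) = a (w + z) (w - z) :=
  h.form_eq (w + z) (w - z)

theorem form_sub_add (h : IsGraphForm W a) (w z : W) :
    (graphForm W a).form (w.1.1 - z.1.1) (w.1.1 + z.1.1) = a (w - z) (w + z) :=
  h.form_eq (w - z) (w + z)

theorem mem_dom {u : H} : u ∈ (graphForm W a).dom ↔ ∃ w : W, w.1.1 = u := by
  simp only [graphForm, Submodule.mem_map, LinearMap.fst_apply, Subtype.exists, exists_prop]

theorem nonneg (h : IsGraphForm W a) (w : W) : 0 ≤ a w w := by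
  obtain ⟨c, hc, h'⟩ := h.coercive
  exact le_trans (by positivity) (h' w)

/-- Coercivity bounds `‖w.1.2‖` by `a(w, w)^{1/2} / √c`, and this is inserted twice into `bound`.
The norm of `H` never enters, so the condition is the strong one. -/
theorem strongSector (h : IsGraphForm W a) :
    ∃ C : ℝ, 0 < C ∧ ∀ w z : W, |a w z| ≤ C * Real.sqrt (a w w) * Real.sqrt (a z z) := by
  obtain ⟨C, hC, hb⟩ := h.bound
  obtain ⟨c, hc, h'⟩ := h.coercive
  have key : ∀ w : W, ‖w.1.2‖ ≤ (Real.sqrt c)⁻¹ * Real.sqrt (a w w) := fun w => by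
    have h1 := Real.sqrt_le_sqrt (h' w)
    rw [Real.sqrt_mul hc.le, Real.sqrt_sq (norm_nonneg _)] at h1
    rwa [inv_mul_eq_div, le_div_iff₀' (Real.sqrt_pos.2 hc)]
  refine ⟨C * (Real.sqrt c)⁻¹ * (Real.sqrt c)⁻¹, by positivity, fun w z => ?_⟩
  calc |a w z| ≤ C * ‖w.1.2‖ * ‖z.1.2‖ := hb w z
    _ ≤ C * ((Real.sqrt c)⁻¹ * Real.sqrt (a w w)) * ((Real.sqrt c)⁻¹ * Real.sqrt (a z z)) := by
        gcongr <;> exact key _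
    _ = _ := by ring

theorem tendsto_apply (a : W →L[ℝ] W →L[ℝ] ℝ) {ι : Type*} {l : Filter ι} {s t : ι → W} {w z : W}
    (hs : Tendsto s l (𝓝 w)) (ht : Tendsto t l (𝓝 z)) :
    Tendsto (fun i => a (s i) (t i)) l (𝓝 (a w z)) :=
  (a.continuous₂.tendsto (w, z)).comp (hs.prodMk_nhds ht)

/-- A sequence in `W` is Cauchy if its first components are Cauchy in `H` and it is Cauchy for
`a`. -/
theorem cauchySeq (h : IsGraphForm W a) {t : ℕ → W} (h1 : CauchySeq fun n => (t n).1.1)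
    (h2 : Tendsto (fun k : ℕ × ℕ => a (t k.1 - t k.2) (t k.1 - t k.2)) atTop (𝓝 0)) :
    CauchySeq t := by
  obtain ⟨c, hc, h'⟩ := h.coercive
  have h3 : CauchySeq fun n => (t n).1.2 := by
    rw [cauchySeq_iff_tendsto_dist_atTop_0]
    have h4 : Tendsto (fun k : ℕ × ℕ => Real.sqrt (c⁻¹ * a (t k.1 - t k.2) (t k.1 - t k.2)))
        atTop (𝓝 0) := by
      simpa using (h2.const_mul c⁻¹).sqrt
    refine squeeze_zero (fun _ => dist_nonneg) (fun k => ?_) h4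
    rw [dist_eq_norm]
    apply Real.le_sqrt_of_sq_le
    rw [inv_mul_eq_div, le_div_iff₀' hc]
    exact h' (t k.1 - t k.2)
  have h5 : CauchySeq fun n => ((t n).1.1, (t n).1.2) := h1.prodMk h3
  rw [CauchySeq, ← (isUniformEmbedding_subtype_val
    (p := fun x => x ∈ W)).isUniformInducing.cauchy_map_iff, map_map]
  exact h5

variable {E₀ : DomForm H}

/-- Completeness of `W` for the form `a` together with the norm of `H`. -/
theorem exists_tendsto [CompleteSpace H] [CompleteSpace K] (h : IsGraphForm W a)
    (hW : IsClosed (W : Set (H × K))) {t : ℕ → W} (h1 : CauchySeq fun n => (t n).1.1)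
    (h2 : Tendsto (fun k : ℕ × ℕ => a (t k.1 - t k.2) (t k.1 - t k.2)) atTop (𝓝 0)) :
    ∃ w : W, Tendsto t atTop (𝓝 w) := by
  have : CompleteSpace W := hW.completeSpace_coe
  exact cauchySeq_tendsto_of_complete (h.cauchySeq h1 h2)

theorem tendsto_fst {ι : Type*} {l : Filter ι} {t : ι → W} {w : W} (ht : Tendsto t l (𝓝 w)) :
    Tendsto (fun i => (t i).1.1) l (𝓝 w.1.1) :=
  (continuous_fst.comp continuous_subtype_val).tendsto w |>.comp ht

theorem form₁_eq (h : IsGraphForm W a) (w z : W) :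
    (graphForm W a).form₁ w.1.1 z.1.1 = a w z + inner ℝ w.1.1 z.1.1 := by
  rw [DomForm.form₁, h.form_eq]

theorem isBilinear (h : IsGraphForm W a) : (graphForm W a).IsBilinear := by
  constructor <;> intro u hu v hv w hw c <;>
  obtain ⟨u, rfl⟩ := mem_dom.1 hu <;> obtain ⟨v, rfl⟩ := mem_dom.1 hv <;>
  obtain ⟨w, rfl⟩ := mem_dom.1 hw <;>
  have e : c • u.1.1 + v.1.1 = (c • u + v).1.1 := rfl <;>
  rw [e, h.form_eq, h.form_eq, h.form_eq] <;> simp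

theorem isPositive (h : IsGraphForm W a) : (graphForm W a).IsPositive := by
  intro u hu
  obtain ⟨u, rfl⟩ := mem_dom.1 hu
  rw [h.form_eq]
  exact h.nonneg u

/-- The strong sector condition handles `a` and Cauchy–Schwarz in `H` handles the inner product,
which accounts for the constant `C + 1`. -/
theorem weakSector (h : IsGraphForm W a) : (graphForm W a).WeakSector := by
  obtain ⟨C, hC, hs⟩ := h.strongSector
  refine ⟨C + 1, by positivity, fun u hu v hv => ?_⟩
  obtain ⟨u, rfl⟩ := mem_dom.1 hu
  obtain ⟨v, rfl⟩ := mem_dom.1 hv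
  simp only [h.form₁_eq, real_inner_self_eq_norm_sq]
  have hu0 := h.nonneg u
  have hv0 := h.nonneg v
  have hu1 : Real.sqrt (a u u) ≤ Real.sqrt (a u u + ‖u.1.1‖ ^ 2) :=
    Real.sqrt_le_sqrt (by nlinarith [sq_nonneg ‖u.1.1‖])
  have hv1 : Real.sqrt (a v v) ≤ Real.sqrt (a v v + ‖v.1.1‖ ^ 2) :=
    Real.sqrt_le_sqrt (by nlinarith [sq_nonneg ‖v.1.1‖])
  have hu2 : ‖u.1.1‖ ≤ Real.sqrt (a u u + ‖u.1.1‖ ^ 2) := Real.le_sqrt_of_sq_le (by linarith)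
  have hv2 : ‖v.1.1‖ ≤ Real.sqrt (a v v + ‖v.1.1‖ ^ 2) := Real.le_sqrt_of_sq_le (by linarith)
  calc |a u v + inner ℝ u.1.1 v.1.1| ≤ |a u v| + |inner ℝ u.1.1 v.1.1| := abs_add_le _ _
    _ ≤ C * Real.sqrt (a u u) * Real.sqrt (a v v) + ‖u.1.1‖ * ‖v.1.1‖ :=
        add_le_add (hs u v) (abs_real_inner_le_norm _ _)
    _ ≤ C * Real.sqrt (a u u + ‖u.1.1‖ ^ 2) * Real.sqrt (a v v + ‖v.1.1‖ ^ 2) +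
          Real.sqrt (a u u + ‖u.1.1‖ ^ 2) * Real.sqrt (a v v + ‖v.1.1‖ ^ 2) := by gcongr
    _ = _ := by ring

/-- `E₀` is the restriction of the form induced by `a` to the projection of `T ⊆ W`. -/
structure IsCore (E₀ : DomForm H) (T W : Submodule ℝ (H × K)) (a : W →L[ℝ] W →L[ℝ] ℝ) : Prop where
  closure_eq : T.topologicalClosure = W
  dom_eq : E₀.dom = T.map (LinearMap.fst ℝ H K)
  form_eq : ∀ w z : W, w.1 ∈ T → z.1 ∈ T → E₀.form w.1.1 z.1.1 = a w z

theorem IsCore.exists_lift (hE : IsCore E₀ T W a) {u : H} (hu : u ∈ E₀.dom) :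
    ∃ w : W, w.1 ∈ T ∧ w.1.1 = u := by
  rw [hE.dom_eq] at hu
  obtain ⟨w, hw, rfl⟩ := hu
  exact ⟨⟨w, hE.closure_eq ▸ T.le_topologicalClosure hw⟩, hw, rfl⟩

theorem IsCore.mem_dom (hE : IsCore E₀ T W a) {w : W} (hw : w.1 ∈ T) : w.1.1 ∈ E₀.dom := by
  rw [hE.dom_eq]
  exact ⟨w.1, hw, rfl⟩

theorem IsCore.isClosed (hE : IsCore E₀ T W a) : IsClosed (W : Set (H × K)) := by
  rw [← hE.closure_eq]
  exact T.isClosed_topologicalClosure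

theorem IsCore.extends_graphForm (h : IsGraphForm W a) (hE : IsCore E₀ T W a) :
    (graphForm W a).Extends E₀ := by
  refine ⟨fun u hu => ?_, fun u hu v hv => ?_⟩
  · obtain ⟨w, -, rfl⟩ := hE.exists_lift hu
    exact IsGraphForm.mem_dom.2 ⟨w, rfl⟩
  · obtain ⟨w, hw, rfl⟩ := hE.exists_lift hu
    obtain ⟨z, hz, rfl⟩ := hE.exists_lift hv
    rw [h.form_eq, hE.form_eq w z hw hz]

theorem IsCore.exists_seq (hE : IsCore E₀ T W a) (w : W) :
    ∃ t : ℕ → W, (∀ n, (t n).1 ∈ T) ∧ Tendsto t atTop (𝓝 w) := by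
  have hw : w.1 ∈ closure (T : Set (H × K)) := by
    rw [← Submodule.topologicalClosure_coe, hE.closure_eq]
    exact w.2
  obtain ⟨t, ht, hlim⟩ := mem_closure_iff_seq_limit.1 hw
  exact ⟨fun n => ⟨t n, hE.closure_eq ▸ T.le_topologicalClosure (ht n)⟩, ht,
    tendsto_subtype_rng.2 hlim⟩

theorem tendsto_sub_self {t : ℕ → W} {w : W} (ht : Tendsto t atTop (𝓝 w)) :
    Tendsto (fun k : ℕ × ℕ => a (t k.1 - t k.2) (t k.1 - t k.2)) atTop (𝓝 0) := by
  have h1 : Tendsto (fun k : ℕ × ℕ => t k.1 - t k.2) atTop (𝓝 (w - w)) := by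
    rw [← prod_atTop_atTop_eq]
    exact (ht.comp Filter.tendsto_fst).sub (ht.comp Filter.tendsto_snd)
  simpa using tendsto_apply a h1 h1

theorem IsCore.isCauchy (hE : IsCore E₀ T W a) {t : ℕ → W} (hT : ∀ n, (t n).1 ∈ T) {w : W}
    (ht : Tendsto t atTop (𝓝 w)) : E₀.IsCauchy fun n => (t n).1.1 := by
  refine ⟨fun n => hE.mem_dom (hT n), ?_⟩
  refine (tendsto_sub_self (a := a) ht).congr fun k => ?_
  exact (hE.form_eq (t k.1 - t k.2) (t k.1 - t k.2) (T.sub_mem (hT _) (hT _))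
    (T.sub_mem (hT _) (hT _))).symm

/-- Every form-Cauchy sequence that converges in `H` lifts to a convergent sequence in `W`. -/
theorem IsCore.exists_lift_seq [CompleteSpace H] [CompleteSpace K] (h : IsGraphForm W a)
    (hE : IsCore E₀ T W a) {s : ℕ → H} (hs : E₀.IsCauchy s) {u : H} (hu : Tendsto s atTop (𝓝 u)) :
    ∃ (t : ℕ → W) (w : W), (∀ n, (t n).1 ∈ T) ∧ (∀ n, (t n).1.1 = s n) ∧ w.1.1 = u ∧
      Tendsto t atTop (𝓝 w) := by
  choose t hT hts using fun n => hE.exists_lift (hs.1 n)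
  obtain ⟨w, hw⟩ := h.exists_tendsto hE.isClosed (t := t)
    (by simpa only [hts] using hu.cauchySeq) (by
      refine hs.2.congr fun k => ?_
      rw [← hE.form_eq (t k.1 - t k.2) (t k.1 - t k.2) (T.sub_mem (hT _) (hT _))
        (T.sub_mem (hT _) (hT _))]
      simp [hts])
  refine ⟨t, w, hT, hts, ?_, hw⟩
  refine tendsto_nhds_unique (IsGraphForm.tendsto_fst hw) ?_
  simpa only [hts] using hu

theorem IsCore.isClosable [CompleteSpace H] [CompleteSpace K] (h : IsGraphForm W a)
    (hE : IsCore E₀ T W a) : E₀.IsClosable := by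
  obtain ⟨hle, hform⟩ := hE.extends_graphForm h
  refine ⟨⟨fun u hu v hv w hw c => ?_, fun u hu v hv w hw c => ?_⟩, fun u hu => ?_, ?_,
    fun s hs h0 => ?_⟩
  · rw [← hform _ (E₀.dom.add_mem (E₀.dom.smul_mem c hu) hv) _ hw, ← hform _ hu _ hw,
      ← hform _ hv _ hw]
    exact h.isBilinear.1 u (hle hu) v (hle hv) w (hle hw) c
  · rw [← hform _ hw _ (E₀.dom.add_mem (E₀.dom.smul_mem c hu) hv), ← hform _ hw _ hu,
      ← hform _ hw _ hv]
    exact h.isBilinear.2 u (hle hu) v (hle hv) w (hle hw) c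
  · rw [← hform _ hu _ hu]
    exact h.isPositive u (hle hu)
  · obtain ⟨C, hC, hs⟩ := h.weakSector
    refine ⟨C, hC, fun u hu v hv => ?_⟩
    have := hs u (hle hu) v (hle hv)
    simpa only [DomForm.form₁, hform _ hu _ hv, hform _ hu _ hu, hform _ hv _ hv] using this
  · obtain ⟨t, w, hT, hts, hw0, hlim⟩ := hE.exists_lift_seq h hs h0
    -- Closability proper: the lifted sequence converges in `W` to a point over `0`, and the graph
    -- property forces that point to be `0`.
    obtain rfl := h.graph w hw0
    have := tendsto_apply a hlim hlim
    simp only [map_zero] at this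
    refine this.congr fun n => ?_
    rw [← hE.form_eq _ _ (hT n) (hT n), hts]

theorem IsCore.isClosureOf [CompleteSpace H] [CompleteSpace K] (h : IsGraphForm W a)
    (hE : IsCore E₀ T W a) : (graphForm W a).IsClosureOf E₀ := by
  refine ⟨fun u => ⟨fun hu => ?_, ?_⟩, fun u v s t hs hsu ht htv => ?_⟩
  · obtain ⟨w, rfl⟩ := IsGraphForm.mem_dom.1 hu
    obtain ⟨t, hT, hlim⟩ := hE.exists_seq w
    exact ⟨_, hE.isCauchy hT hlim, IsGraphForm.tendsto_fst hlim⟩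
  · rintro ⟨s, hs, hu⟩
    obtain ⟨-, w, -, -, hw, -⟩ := hE.exists_lift_seq h hs hu
    exact IsGraphForm.mem_dom.2 ⟨w, hw⟩
  · obtain ⟨s', w, hsT, hs', rfl, hsw⟩ := hE.exists_lift_seq h hs hsu
    obtain ⟨t', z, htT, ht', rfl, htz⟩ := hE.exists_lift_seq h ht htv
    rw [h.form_eq]
    refine (tendsto_apply a hsw htz).congr fun n => ?_
    rw [← hE.form_eq _ _ (hsT n) (htT n), hs', ht']

theorem tendsto_form₁_sub (h : IsGraphForm W a) {t : ℕ → W} {w : W}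
    (ht : Tendsto t atTop (𝓝 w)) :
    Tendsto (fun n => (graphForm W a).form₁ ((t n).1.1 - w.1.1) ((t n).1.1 - w.1.1))
      atTop (𝓝 0) := by
  have h1 : Tendsto (fun n => t n - w) atTop (𝓝 0) := by simpa using ht.sub_const w
  have h2 := tendsto_apply a h1 h1
  have h3 := ((IsGraphForm.tendsto_fst h1).norm).pow 2
  have h4 := h2.add h3
  rw [show a 0 0 + ‖((0 : W) : H × K).1‖ ^ 2 = 0 by simp] at h4
  refine h4.congr fun n => ?_
  rw [← real_inner_self_eq_norm_sq]
  exact (h.form₁_eq (t n - w) (t n - w)).symm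

/-- A `form₁`-Cauchy sequence is Cauchy both in `H` and for `a`, because `form₁` is the sum of two
nonnegative terms. Its lift therefore converges in the complete space `W`. -/
theorem isCoerciveClosed [CompleteSpace H] [CompleteSpace K] (h : IsGraphForm W a)
    (hW : IsClosed (W : Set (H × K))) (hd : Dense ((graphForm W a).dom : Set H)) :
    (graphForm W a).IsCoerciveClosed := by
  refine ⟨hd, h.isBilinear, h.isPositive, fun s hs hlim => ?_, h.weakSector⟩
  choose t ht using fun n => mem_dom.1 (hs n)
  have key : ∀ k : ℕ × ℕ, (graphForm W a).form₁ (s k.1 - s k.2) (s k.1 - s k.2) =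
      a (t k.1 - t k.2) (t k.1 - t k.2) + ‖s k.1 - s k.2‖ ^ 2 := fun k => by
    have := h.form₁_eq (t k.1 - t k.2) (t k.1 - t k.2)
    simpa [ht, real_inner_self_eq_norm_sq, -map_sub] using this
  simp only [key] at hlim
  have h1 : CauchySeq s := by
    rw [cauchySeq_iff_tendsto_dist_atTop_0]
    have h4 := hlim.sqrt
    rw [Real.sqrt_zero] at h4
    refine squeeze_zero (fun _ => dist_nonneg) (fun k => ?_) h4
    rw [dist_eq_norm]
    exact Real.le_sqrt_of_sq_le (by linarith [h.nonneg (t k.1 - t k.2)])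
  obtain ⟨w, hw⟩ := h.exists_tendsto hW (t := t) (by simpa only [ht] using h1)
    (squeeze_zero (fun k => h.nonneg _) (fun k => by
      linarith [sq_nonneg ‖s k.1 - s k.2‖]) hlim)
  refine ⟨w.1.1, mem_dom.2 ⟨w, rfl⟩, ?_⟩
  simpa only [ht] using h.tendsto_form₁_sub hw

end IsGraphForm

/-! ### Continuity of coercive closed forms and minimality of the closure. -/

namespace DomForm

variable {F : DomForm H}

theorem IsBilinear.sub_left (h : F.IsBilinear) {u v w : H} (hu : u ∈ F.dom) (hv : v ∈ F.dom)
    (hw : w ∈ F.dom) : F.form (u - v) w = F.form u w - F.form v w := by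
  have := h.1 v hv u hu w hw (-1)
  rw [show (-1 : ℝ) • v + u = u - v by module] at this
  linarith

theorem IsBilinear.sub_right (h : F.IsBilinear) {u v w : H} (hu : u ∈ F.dom) (hv : v ∈ F.dom)
    (hw : w ∈ F.dom) : F.form w (u - v) = F.form w u - F.form w v := by
  have := h.2 v hv u hu w hw (-1)
  rw [show (-1 : ℝ) • v + u = u - v by module] at this
  linarith

/-- A coercive closed form is continuous along sequences converging for `F₁`. -/
theorem IsCoerciveClosed.tendsto_form₁ (h : F.IsCoerciveClosed) {s t : ℕ → H} {u v : H}
    (hs : ∀ n, s n ∈ F.dom) (ht : ∀ n, t n ∈ F.dom) (hu : u ∈ F.dom) (hv : v ∈ F.dom)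
    (hsu : Tendsto (fun n => F.form₁ (s n - u) (s n - u)) atTop (𝓝 0))
    (htv : Tendsto (fun n => F.form₁ (t n - v) (t n - v)) atTop (𝓝 0)) :
    Tendsto (fun n => F.form₁ (s n) (t n)) atTop (𝓝 (F.form₁ u v)) := by
  obtain ⟨K, hK, hsec⟩ := h.weakSector
  -- In each of the three terms at least one argument tends to zero for `form₁`, so the weak sector
  -- condition makes each term vanish in the limit.
  have e : ∀ n, F.form₁ (s n) (t n) - F.form₁ u v =
      F.form₁ (s n - u) (t n - v) + F.form₁ (s n - u) v + F.form₁ u (t n - v) := fun n => by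
    simp only [form₁, h.bilinear.sub_left (hs n) hu (F.dom.sub_mem (ht n) hv),
      h.bilinear.sub_left (hs n) hu hv, h.bilinear.sub_right (ht n) hv hu,
      h.bilinear.sub_right (ht n) hv (hs n), inner_sub_left, inner_sub_right]
    ring
  have z : ∀ (x y : ℕ → H), (∀ n, x n ∈ F.dom) → (∀ n, y n ∈ F.dom) →
      Tendsto (fun n => Real.sqrt (F.form₁ (x n) (x n)) * Real.sqrt (F.form₁ (y n) (y n)))
        atTop (𝓝 0) → Tendsto (fun n => F.form₁ (x n) (y n)) atTop (𝓝 0) := by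
    intro x y hx hy hlim
    refine squeeze_zero_norm (fun n => ?_) (by simpa using hlim.const_mul K)
    rw [Real.norm_eq_abs, ← mul_assoc]
    exact hsec _ (hx n) _ (hy n)
  have hs' := hsu.sqrt
  have ht' := htv.sqrt
  rw [Real.sqrt_zero] at hs' ht'
  have z1 := z (fun n => s n - u) (fun n => t n - v) (fun n => F.dom.sub_mem (hs n) hu)
    (fun n => F.dom.sub_mem (ht n) hv) (by simpa using hs'.mul ht')
  have z2 := z (fun n => s n - u) (fun _ => v) (fun n => F.dom.sub_mem (hs n) hu)
    (fun _ => hv) (by simpa using hs'.mul_const _)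
  have z3 := z (fun _ => u) (fun n => t n - v) (fun _ => hu)
    (fun n => F.dom.sub_mem (ht n) hv) (by simpa using ht'.const_mul _)
  rw [← tendsto_sub_nhds_zero_iff]
  simp only [e]
  simpa using (z1.add z2).add z3

theorem IsCoerciveClosed.tendsto_of_form₁ (h : F.IsCoerciveClosed) {s : ℕ → H} {u : H}
    (hs : ∀ n, s n ∈ F.dom) (hu : u ∈ F.dom)
    (hsu : Tendsto (fun n => F.form₁ (s n - u) (s n - u)) atTop (𝓝 0)) :
    Tendsto s atTop (𝓝 u) := by
  rw [tendsto_iff_norm_sub_tendsto_zero]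
  have h4 := hsu.sqrt
  rw [Real.sqrt_zero] at h4
  refine squeeze_zero (fun _ => norm_nonneg _) (fun n => ?_) h4
  apply Real.le_sqrt_of_sq_le
  rw [form₁, real_inner_self_eq_norm_sq]
  linarith [h.positive _ (F.dom.sub_mem (hs n) hu)]

/-- A closure that is a coercive closed form is the smallest coercive closed extension. -/
theorem IsClosureOf.isSmallest {E₀ : DomForm H} (hc : F.IsClosureOf E₀) (hF : F.IsCoerciveClosed)
    (he : F.Extends E₀) : F.IsSmallestCoerciveClosedExtension E₀ := by
  refine ⟨hF, he, fun F' hF' he' => ?_⟩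
  have key : ∀ (s : ℕ → H) (u : H), E₀.IsCauchy s → Tendsto s atTop (𝓝 u) →
      u ∈ F'.dom ∧ Tendsto (fun n => F'.form₁ (s n - u) (s n - u)) atTop (𝓝 0) := by
    intro s u hs hu
    have hcs : Tendsto (fun k : ℕ × ℕ => F'.form₁ (s k.1 - s k.2) (s k.1 - s k.2))
        atTop (𝓝 0) := by
      have h1 := (cauchySeq_iff_tendsto_dist_atTop_0.1 hu.cauchySeq).pow 2
      have h2 := hs.2.add h1
      rw [zero_pow two_ne_zero, add_zero] at h2
      refine h2.congr fun k => ?_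
      have hk := E₀.dom.sub_mem (hs.1 k.1) (hs.1 k.2)
      rw [form₁, he'.2 _ hk _ hk, real_inner_self_eq_norm_sq, dist_eq_norm]
    obtain ⟨v, hv, hlim⟩ := hF'.complete s (fun n => he'.1 (hs.1 n)) hcs
    have := hF'.tendsto_of_form₁ (fun n => he'.1 (hs.1 n)) hv hlim
    -- Completeness of `F'` produces some limit `v`. As `form₁` dominates the norm of `H`, it must
    -- be the limit `u` already known.
    obtain rfl := tendsto_nhds_unique hu this
    exact ⟨hv, hlim⟩
  refine ⟨fun u hu => ?_, fun u hu v hv => ?_⟩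
  · obtain ⟨s, hs, hsu⟩ := (hc.1 u).1 hu
    exact (key s u hs hsu).1
  · obtain ⟨s, hs, hsu⟩ := (hc.1 u).1 hu
    obtain ⟨t, ht, htv⟩ := (hc.1 v).1 hv
    obtain ⟨hu', hsu'⟩ := key s u hs hsu
    obtain ⟨hv', htv'⟩ := key t v ht htv
    have h1 := hF'.tendsto_form₁ (fun n => he'.1 (hs.1 n)) (fun n => he'.1 (ht.1 n)) hu' hv'
      hsu' htv'
    have h2 := (hc.2 u v s t hs hsu ht htv).add (hsu.inner htv (𝕜 := ℝ))
    have h3 := tendsto_nhds_unique h1 (h2.congr fun n => by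
      rw [form₁, he'.2 _ (hs.1 n) _ (ht.1 n)])
    rw [form₁] at h3
    linarith

end DomForm

end GraphForm

/-! ### The reference measure on bounded sets -/

section RefMeasure

variable {d : ℕ} {ρ : Rn d → ℝ} {B : Set (Rn d)}

theorem exists_density_bounds (hc : Continuous ρ) (hpos : ∀ x, 0 < ρ x)
    (hb : Bornology.IsBounded B) : ∃ C : ℝ, 0 < C ∧ ∀ x ∈ B, ρ x ≤ C ∧ (ρ x)⁻¹ ≤ C := by
  have hK : IsCompact (closure B) := hb.isCompact_closure
  obtain ⟨C₁, h₁⟩ := hK.exists_bound_of_continuousOn hc.continuousOn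
  obtain ⟨C₂, h₂⟩ := hK.exists_bound_of_continuousOn
    (hc.inv₀ fun x => (hpos x).ne').continuousOn
  refine ⟨max (max C₁ C₂) 1, by positivity, fun x hx => ⟨?_, ?_⟩⟩
  · exact (le_abs_self _).trans ((h₁ x (subset_closure hx)).trans (by simp))
  · exact (le_abs_self _).trans ((h₂ x (subset_closure hx)).trans (by simp))

/-- The two-sided bound on the density is what allows null sets, integrability and `L^q` convergence
on `B` to be transferred between `ρ dx` and `dx`. -/
theorem exists_refMeasure_comparable (hc : Continuous ρ) (hpos : ∀ x, 0 < ρ x)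
    (hb : Bornology.IsBounded B) (hB : MeasurableSet B) :
    ∃ C : ℝ≥0∞, C ≠ ⊤ ∧ (refMeasure ρ).restrict B ≤ C • (volume : Measure (Rn d)).restrict B ∧
      (volume : Measure (Rn d)).restrict B ≤ C • (refMeasure ρ).restrict B := by
  obtain ⟨C, hC, hbd⟩ := exists_density_bounds hc hpos hb
  have hm : Measurable fun x => ENNReal.ofReal (ρ x) := hc.measurable.ennreal_ofReal
  refine ⟨ENNReal.ofReal C, by simp, ?_, ?_⟩
  · rw [refMeasure, restrict_withDensity hB, ← withDensity_const]
    refine withDensity_mono ?_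
    filter_upwards [ae_restrict_mem hB] with x hx
    exact ENNReal.ofReal_le_ofReal (hbd x hx).1
  · rw [refMeasure, restrict_withDensity hB, ← withDensity_smul _ hm]
    nth_rw 1 [← withDensity_one (μ := volume.restrict B)]
    refine withDensity_mono ?_
    filter_upwards [ae_restrict_mem hB] with x hx
    simp only [Pi.one_apply, Pi.smul_apply, smul_eq_mul]
    rw [← ENNReal.ofReal_mul hC.le, ← ENNReal.ofReal_one]
    refine ENNReal.ofReal_le_ofReal ?_
    have := (hbd x hx).2
    rwa [inv_le_iff_one_le_mul₀ (hpos x)] at this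

theorem ae_refMeasure_eq (hc : Continuous ρ) (hpos : ∀ x, 0 < ρ x)
    (hb : Bornology.IsBounded B) (hB : MeasurableSet B) :
    ae ((refMeasure ρ).restrict B) = ae ((volume : Measure (Rn d)).restrict B) := by
  obtain ⟨C, -, h₁, h₂⟩ := exists_refMeasure_comparable hc hpos hb hB
  exact le_antisymm
    (Measure.ae_le_iff_absolutelyContinuous.2 (Measure.absolutelyContinuous_of_le_smul h₁))
    (Measure.ae_le_iff_absolutelyContinuous.2 (Measure.absolutelyContinuous_of_le_smul h₂))

theorem memLp_refMeasure_iff {F : Type*} [NormedAddCommGroup F] (hc : Continuous ρ)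
    (hpos : ∀ x, 0 < ρ x) (hb : Bornology.IsBounded B) (hB : MeasurableSet B) {f : Rn d → F}
    {q : ℝ≥0∞} : MemLp f q ((refMeasure ρ).restrict B) ↔ MemLp f q (volume.restrict B) := by
  obtain ⟨C, hC, h₁, h₂⟩ := exists_refMeasure_comparable hc hpos hb hB
  exact ⟨fun h => h.of_measure_le_smul hC h₂, fun h => h.of_measure_le_smul hC h₁⟩

theorem tendsto_eLpNorm_of_measure_le {X F : Type*} [MeasurableSpace X] [NormedAddCommGroup F]
    {m m' : Measure X} {C q : ℝ≥0∞} (hC : C ≠ ⊤) (h : m' ≤ C • m) {f : ℕ → X → F}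
    (hf : Tendsto (fun n => eLpNorm (f n) q m) atTop (𝓝 0)) :
    Tendsto (fun n => eLpNorm (f n) q m') atTop (𝓝 0) := by
  have h1 := ENNReal.Tendsto.const_mul (a := C ^ (1 / q).toReal) hf
    (Or.inr (ENNReal.rpow_ne_top_of_nonneg ENNReal.toReal_nonneg hC))
  rw [mul_zero] at h1
  exact tendsto_of_tendsto_of_tendsto_of_le_of_le tendsto_const_nhds h1 (fun _ => zero_le)
    fun n => eLpNorm_le_of_measure_le_smul h

theorem tendsto_eLpNorm_refMeasure_iff {F : Type*} [NormedAddCommGroup F] (hc : Continuous ρ)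
    (hpos : ∀ x, 0 < ρ x) (hb : Bornology.IsBounded B) (hB : MeasurableSet B) {f : ℕ → Rn d → F}
    {q : ℝ≥0∞} : Tendsto (fun n => eLpNorm (f n) q ((refMeasure ρ).restrict B)) atTop (𝓝 0) ↔
      Tendsto (fun n => eLpNorm (f n) q (volume.restrict B)) atTop (𝓝 0) := by
  obtain ⟨C, hC, h₁, h₂⟩ := exists_refMeasure_comparable hc hpos hb hB
  exact ⟨tendsto_eLpNorm_of_measure_le hC h₂, tendsto_eLpNorm_of_measure_le hC h₁⟩

theorem isFiniteMeasure_refMeasure_restrict (hc : Continuous ρ) (hpos : ∀ x, 0 < ρ x)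
    (hb : Bornology.IsBounded B) (hB : MeasurableSet B) :
    IsFiniteMeasure ((refMeasure ρ).restrict B) := by
  obtain ⟨C, hC, h₁, -⟩ := exists_refMeasure_comparable hc hpos hb hB
  refine ⟨(h₁ univ).trans_lt ?_⟩
  simpa using ENNReal.mul_lt_top hC.lt_top hb.measure_lt_top

theorem setIntegral_refMeasure {F : Type*} [NormedAddCommGroup F] [NormedSpace ℝ F]
    (hc : Continuous ρ) (hpos : ∀ x, 0 < ρ x) (hB : MeasurableSet B) (g : Rn d → F) :
    ∫ x in B, g x ∂(refMeasure ρ) = ∫ x in B, ρ x • g x := by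
  rw [refMeasure, setIntegral_withDensity_eq_setIntegral_toReal_smul
    hc.measurable.ennreal_ofReal (by simp) g hB]
  simp only [ENNReal.toReal_ofReal (hpos _).le]

end RefMeasure

/-! ### Test functions and their gradients -/

section Test

variable {d : ℕ} {U : Set (Rn d)} {f g : Rn d → ℝ}

theorem gradient_apply_eq_fderiv (f : Rn d → ℝ) (x : Rn d) (i : Fin d) :
    gradient f x i = fderiv ℝ f x (EuclideanSpace.single i 1) := by
  rw [← inner_gradient_left, EuclideanSpace.inner_single_right]
  simp

theorem norm_gradient_eq (f : Rn d → ℝ) (x : Rn d) : ‖gradient f x‖ = ‖fderiv ℝ f x‖ :=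
  LinearIsometryEquiv.norm_map _ _

theorem IsTest.differentiable (hf : IsTest U f) : Differentiable ℝ f :=
  hf.smooth.differentiable (by simp)

theorem IsTest.gradient_add (hf : IsTest U f) (hg : IsTest U g) :
    gradient (f + g) = gradient f + gradient g := by
  ext1 x
  simp only [gradient, Pi.add_apply, fderiv_add (hf.differentiable x) (hg.differentiable x),
    map_add]

theorem IsTest.gradient_smul (hf : IsTest U f) (c : ℝ) :
    gradient (c • f) = c • gradient f := by
  ext1 x
  simp only [gradient, Pi.smul_apply, fderiv_const_smul (hf.differentiable x) c, map_smul]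

theorem gradient_comp_real {φ : ℝ → ℝ} (hφ : Differentiable ℝ φ) (hf : Differentiable ℝ f)
    (x : Rn d) : gradient (φ ∘ f) x = deriv φ (f x) • gradient f x := by
  have h : fderiv ℝ (φ ∘ f) x = deriv φ (f x) • fderiv ℝ f x := by
    ext v
    rw [((hφ _).hasDerivAt.comp_hasFDerivAt x (hf x).hasFDerivAt).fderiv]
  simp only [gradient, h, map_smul]

theorem IsTest.comp {φ : ℝ → ℝ} (hf : IsTest U f) (hφ : ContDiff ℝ ∞ φ) (h0 : φ 0 = 0) :
    IsTest U (φ ∘ f) :=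
  ⟨hφ.comp hf.smooth, hf.compact.comp_left h0,
    (closure_mono (Function.support_comp_subset h0 f)).trans hf.supp⟩

theorem IsTest.continuous_gradient (hf : IsTest U f) : Continuous (gradient f) :=
  (LinearIsometryEquiv.continuous _).comp (hf.smooth.continuous_fderiv (by simp))

theorem tsupport_gradient_subset (f : Rn d → ℝ) : tsupport (gradient f) ⊆ tsupport f := by
  have h : Function.support (gradient f) ⊆ Function.support (fderiv ℝ f) := fun x hx h' =>
    hx (by simpa [gradient] using h')
  exact (closure_mono h).trans (tsupport_fderiv_subset ℝ)

theorem IsTest.hasCompactSupport_gradient (hf : IsTest U f) : HasCompactSupport (gradient f) :=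
  hf.compact.of_isClosed_subset (isClosed_tsupport _) (tsupport_gradient_subset f)

theorem IsTest.eq_zero (hf : IsTest U f) {x : Rn d} (hx : x ∉ U) : f x = 0 :=
  image_eq_zero_of_notMem_tsupport fun h => hx (hf.supp h)

theorem IsTest.gradient_eq_zero (hf : IsTest U f) {x : Rn d} (hx : x ∉ U) : gradient f x = 0 :=
  image_eq_zero_of_notMem_tsupport fun h => hx (hf.supp (tsupport_gradient_subset f h))

theorem IsTest.mono {V : Set (Rn d)} (hf : IsTest U f) (h : U ⊆ V) : IsTest V f :=
  ⟨hf.smooth, hf.compact, hf.supp.trans h⟩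

theorem IsTest.memLp (hf : IsTest U f) (q : ℝ≥0∞) (m : Measure (Rn d)) [IsFiniteMeasure m] :
    MemLp f q m :=
  hf.smooth.continuous.memLp_of_hasCompactSupport hf.compact

theorem IsTest.memLp_gradient (hf : IsTest U f) (q : ℝ≥0∞) (m : Measure (Rn d))
    [IsFiniteMeasure m] : MemLp (gradient f) q m :=
  hf.continuous_gradient.memLp_of_hasCompactSupport hf.hasCompactSupport_gradient

/-- Both integrands vanish off `U`, so this is integration by parts on the whole space, with no
regularity of the boundary of `U`. -/
theorem IsTest.setIntegral_mul_gradient (hf : IsTest U f) (hg : IsTest U g) (i : Fin d) :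
    ∫ x in U, f x * gradient g x i = - ∫ x in U, gradient f x i * g x := by
  rw [setIntegral_eq_integral_of_forall_compl_eq_zero fun x hx => by simp [hf.eq_zero hx],
    setIntegral_eq_integral_of_forall_compl_eq_zero fun x hx => by simp [hg.eq_zero hx]]
  have hci : ∀ {u : Rn d → ℝ}, IsTest U u →
      Continuous fun x => fderiv ℝ u x (EuclideanSpace.single i 1) := fun hu =>
    (hu.smooth.continuous_fderiv (by simp)).clm_apply continuous_const
  simp only [gradient_apply_eq_fderiv]
  refine integral_mul_fderiv_eq_neg_fderiv_mul_of_integrable ?_ ?_ ?_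
    (fun x _ => hf.differentiable x) (fun x _ => hg.differentiable x)
  · exact ((hci hf).mul hg.smooth.continuous).integrable_of_hasCompactSupport hg.compact.mul_left
  · exact (hf.smooth.continuous.mul (hci hg)).integrable_of_hasCompactSupport hf.compact.mul_right
  · exact (hf.smooth.continuous.mul hg.smooth.continuous).integrable_of_hasCompactSupport
      hg.compact.mul_left

/-- A weak gradient on an open set is unique up to a null set. -/
theorem HasWeakGradient.ae_eq (hU : IsOpen U) {F G : Rn d → Rn d} (hf : HasWeakGradient U f F)
    (hg : HasWeakGradient U g G) (hfg : f =ᵐ[volume.restrict U] g) :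
    F =ᵐ[volume.restrict U] G := by
  have key : ∀ i : Fin d, ∀ᵐ x ∂(volume : Measure (Rn d)), x ∈ U → F x i - G x i = 0 := by
    intro i
    have hi : ∀ {V : Rn d → Rn d}, LocallyIntegrableOn V U volume →
        LocallyIntegrableOn (fun x => V x i) U volume := fun {V} hV x hx => by
      obtain ⟨s, hs, hint⟩ := hV x hx
      exact ⟨s, hs, (EuclideanSpace.proj (𝕜 := ℝ) i).integrable_comp hint⟩
    refine hU.ae_eq_zero_of_integral_contDiff_smul_eq_zero
      ((hi hf.locIntGrad).sub (hi hg.locIntGrad)) fun φ h₁ h₂ h₃ => ?_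
    have hφ : IsTest U φ := ⟨h₁, h₂, h₃⟩
    have hint : ∀ {V : Rn d → Rn d}, LocallyIntegrableOn V U volume →
        Integrable (fun x => φ x * V x i) volume := fun hV => by
      have h4 := ((hi hV).integrableOn_compact_subset h₃ h₂).continuousOn_mul
        (g := φ) h₁.continuous.continuousOn h₂
      refine (integrableOn_iff_integrable_of_support_subset ?_).1 h4
      exact fun x hx => subset_tsupport φ fun h => hx (by simp [h])
    have h5 : ∀ {V : Rn d → Rn d}, ∫ x, φ x * V x i = ∫ x in U, V x i * φ x := fun {V} => by
      rw [setIntegral_eq_integral_of_forall_compl_eq_zero fun x hx => by simp [hφ.eq_zero hx]]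
      simp only [mul_comm]
    simp only [smul_eq_mul, mul_sub]
    rw [integral_sub (hint hf.locIntGrad) (hint hg.locIntGrad), h5, h5]
    have h6 : ∫ x in U, f x * gradient φ x i = ∫ x in U, g x * gradient φ x i :=
      integral_congr_ae (by filter_upwards [hfg] with x hx; rw [hx])
    linarith [hf.integral_eq φ hφ i, hg.integral_eq φ hφ i]
  rw [EventuallyEq, ae_restrict_iff' hU.measurableSet]
  filter_upwards [ae_all_iff.2 key] with x hx hxU
  ext i
  exact sub_eq_zero.1 (hx i hxU)

end Test

/-! ### The space of functions in `H₀^{1,2}` paired with their weak gradients -/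

section GradPairs

variable {d : ℕ}

/-- The pairs `(f, ∇f)` with `f ∈ C₀^∞(U)`, as a subspace of `L²(m) × L²(m; ℝ^d)`. -/
def gradPairs (m : Measure (Rn d)) (U : Set (Rn d)) : Submodule ℝ (Lp ℝ 2 m × Lp (Rn d) 2 m) where
  carrier := {w | ∃ f : Rn d → ℝ, IsTest U f ∧ w.1 =ᵐ[m] f ∧ w.2 =ᵐ[m] gradient f}
  zero_mem' := by
    refine ⟨0, IsTest.zero U, Lp.coeFn_zero ℝ 2 _, ?_⟩
    have : gradient (0 : Rn d → ℝ) = 0 := by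
      ext1 x
      simp [gradient]
    rw [this]
    exact Lp.coeFn_zero _ 2 _
  add_mem' := by
    rintro u v ⟨f, hf, hu₁, hu₂⟩ ⟨g, hg, hv₁, hv₂⟩
    refine ⟨f + g, hf.add hg, (Lp.coeFn_add u.1 v.1).trans (hu₁.add hv₁), ?_⟩
    rw [hf.gradient_add hg]
    exact (Lp.coeFn_add u.2 v.2).trans (hu₂.add hv₂)
  smul_mem' := by
    rintro c u ⟨f, hf, hu₁, hu₂⟩
    refine ⟨c • f, hf.smul c, (Lp.coeFn_smul c u.1).trans (hu₁.const_smul c), ?_⟩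
    rw [hf.gradient_smul c]
    exact (Lp.coeFn_smul c u.2).trans (hu₂.const_smul c)

/-- The closure of the pairs `(f, ∇f)`, `f ∈ C₀^∞(U)`, in `L²(m) × L²(m; ℝ^d)`. -/
def h10Pairs (m : Measure (Rn d)) (U : Set (Rn d)) : Submodule ℝ (Lp ℝ 2 m × Lp (Rn d) 2 m) :=
  (gradPairs m U).topologicalClosure

variable {m : Measure (Rn d)} {U : Set (Rn d)}

theorem gradPairs_le : gradPairs m U ≤ h10Pairs m U := Submodule.le_topologicalClosure _

theorem isClosed_h10Pairs : IsClosed (h10Pairs m U : Set (Lp ℝ 2 m × Lp (Rn d) 2 m)) :=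
  Submodule.isClosed_topologicalClosure _

/-- The pair `(f, ∇f)`. -/
def IsTest.pair {f : Rn d → ℝ} (hf : IsTest U f) (m : Measure (Rn d)) [IsFiniteMeasure m] :
    h10Pairs m U :=
  ⟨((hf.memLp 2 m).toLp f, (hf.memLp_gradient 2 m).toLp (gradient f)),
    gradPairs_le ⟨f, hf, (hf.memLp 2 m).coeFn_toLp, (hf.memLp_gradient 2 m).coeFn_toLp⟩⟩

variable [IsFiniteMeasure m]

theorem IsTest.pair_fst {f : Rn d → ℝ} (hf : IsTest U f) : (hf.pair m).1.1 =ᵐ[m] f :=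
  (hf.memLp 2 m).coeFn_toLp

theorem IsTest.pair_snd {f : Rn d → ℝ} (hf : IsTest U f) : (hf.pair m).1.2 =ᵐ[m] gradient f :=
  (hf.memLp_gradient 2 m).coeFn_toLp

theorem IsTest.pair_mem {f : Rn d → ℝ} (hf : IsTest U f) : (hf.pair m).1 ∈ gradPairs m U :=
  ⟨f, hf, hf.pair_fst, hf.pair_snd⟩

theorem exists_eq_pair {w : h10Pairs m U} (hw : w.1 ∈ gradPairs m U) :
    ∃ (f : Rn d → ℝ) (hf : IsTest U f), w = hf.pair m := by
  obtain ⟨f, hf, h₁, h₂⟩ := hw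
  exact ⟨f, hf, Subtype.ext (Prod.ext (Lp.ext (h₁.trans hf.pair_fst.symm))
    (Lp.ext (h₂.trans hf.pair_snd.symm)))⟩

/-- Elements of `h10Pairs` are limits of pairs `(f, ∇f)`, with almost everywhere convergence of the
functions. -/
theorem exists_pair_tendsto (w : h10Pairs m U) :
    ∃ (f : ℕ → Rn d → ℝ) (hf : ∀ n, IsTest U (f n)),
      Tendsto (fun n => (hf n).pair m) atTop (𝓝 w) ∧
      (∀ᵐ x ∂m, Tendsto (fun n => f n x) atTop (𝓝 (w.1.1 x))) ∧
      ∀ᵐ x ∂m, Tendsto (fun n => gradient (f n) x) atTop (𝓝 (w.1.2 x)) := by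
  have hw : w.1 ∈ closure (gradPairs m U : Set (Lp ℝ 2 m × Lp (Rn d) 2 m)) := w.2
  obtain ⟨t, ht, hlim⟩ := mem_closure_iff_seq_limit.1 hw
  choose f hf heq using fun n => exists_eq_pair (w := ⟨t n, gradPairs_le (ht n)⟩) (ht n)
  have h₀ : Tendsto (fun n => (hf n).pair m) atTop (𝓝 w) := by
    rw [tendsto_subtype_rng]
    exact hlim.congr fun n => congrArg Subtype.val (heq n)
  have h₁ := (continuous_fst.comp continuous_subtype_val).tendsto w |>.comp h₀
  obtain ⟨n₁, hn₁, hae₁⟩ := (tendstoInMeasure_of_tendsto_Lp h₁).exists_seq_tendsto_ae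
  have h₂ := ((continuous_snd.comp continuous_subtype_val).tendsto w |>.comp h₀).comp
    hn₁.tendsto_atTop
  obtain ⟨n₂, hn₂, hae₂⟩ := (tendstoInMeasure_of_tendsto_Lp h₂).exists_seq_tendsto_ae
  refine ⟨fun n => f (n₁ (n₂ n)), fun n => hf _,
    h₀.comp (hn₁.tendsto_atTop.comp hn₂.tendsto_atTop), ?_, ?_⟩
  · filter_upwards [hae₁, ae_all_iff.2 fun n => (hf n).pair_fst (m := m)] with x hx hfx
    exact (hx.comp hn₂.tendsto_atTop).congr fun n => hfx _
  · filter_upwards [hae₂, ae_all_iff.2 fun n => (hf n).pair_snd (m := m)] with x hx hfx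
    exact hx.congr fun n => hfx _

/-! ### Convergence in `L²` -/

theorem tendsto_eLpNorm_of_dominated {X F : Type*} [MeasurableSpace X] [NormedAddCommGroup F]
    {ν : Measure X} {f : ℕ → X → F} {g : X → F} (hf : ∀ n, AEStronglyMeasurable (f n) ν)
    (hg : MemLp g 2 ν) (hle : ∀ n, ∀ᵐ x ∂ν, ‖f n x‖ ≤ ‖g x‖)
    (hlim : ∀ᵐ x ∂ν, Tendsto (fun n => f n x) atTop (𝓝 0)) :
    Tendsto (fun n => eLpNorm (f n) 2 ν) atTop (𝓝 0) := by
  have e : ∀ u : X → F, eLpNorm u 2 ν = (∫⁻ x, ‖u x‖ₑ ^ (2 : ℝ) ∂ν) ^ (1 / 2 : ℝ) := fun u => by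
    rw [eLpNorm_eq_lintegral_rpow_enorm_toReal (by simp) (by simp)]
    simp
  have h1 : Tendsto (fun n => ∫⁻ x, ‖f n x‖ₑ ^ (2 : ℝ) ∂ν) atTop (𝓝 (∫⁻ _, 0 ∂ν)) := by
    refine tendsto_lintegral_of_dominated_convergence' (fun x => ‖g x‖ₑ ^ (2 : ℝ))
      (fun n => (hf n).enorm.pow_const _) (fun n => ?_) ?_ ?_
    · filter_upwards [hle n] with x hx
      gcongr
      exact enorm_le_iff_norm_le.2 hx
    · have := hg.2
      rw [e] at this
      intro h
      rw [h] at this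
      simp at this
    · filter_upwards [hlim] with x hx
      have := ((ENNReal.continuous_rpow_const (y := 2)).tendsto _).comp hx.enorm
      simpa [Function.comp_def] using this
  simp only [e]
  have := ((ENNReal.continuous_rpow_const (y := 1 / 2)).tendsto _).comp h1
  simpa [Function.comp_def] using this

/-- Convergence of products `cₙ Gₙ` in `L²`, for bounded multipliers `cₙ` converging almost
everywhere. -/
theorem tendsto_toLp_smul {X F : Type*} [MeasurableSpace X] [NormedAddCommGroup F]
    [NormedSpace ℝ F] {ν : Measure X} {c : ℕ → X → ℝ} {c' : X → ℝ} {G : ℕ → Lp F 2 ν}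
    {G' : Lp F 2 ν} {V : ℕ → Lp F 2 ν} {V' : Lp F 2 ν}
    (hc : ∀ n x, |c n x| ≤ 1) (hcm : ∀ n, AEStronglyMeasurable (c n) ν)
    (hlim : ∀ᵐ x ∂ν, Tendsto (fun n => c n x) atTop (𝓝 (c' x)))
    (hG : Tendsto G atTop (𝓝 G')) (hV : ∀ n, V n =ᵐ[ν] fun x => c n x • G n x)
    (hV' : V' =ᵐ[ν] fun x => c' x • G' x) : Tendsto V atTop (𝓝 V') := by
  have hcm' : AEStronglyMeasurable c' ν := aestronglyMeasurable_of_tendsto_ae atTop hcm hlim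
  rw [Lp.tendsto_Lp_iff_tendsto_eLpNorm'] at hG ⊢
  -- The difference splits as `cₙ (Gₙ - G') + (cₙ - c') G'`. Almost everywhere convergence of `cₙ`
  -- is needed only against the fixed function `G'`, where dominated convergence applies.
  have h1 : Tendsto (fun n => eLpNorm (fun x => (c n x - c' x) • G' x) 2 ν) atTop (𝓝 0) := by
    refine tendsto_eLpNorm_of_dominated (g := fun x => (2 : ℝ) • G' x)
      (fun n => ((hcm n).sub hcm').smul (Lp.aestronglyMeasurable G'))
      ((Lp.memLp G').const_smul 2) (fun n => ?_) ?_
    · filter_upwards [hlim] with x hx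
      rw [norm_smul, norm_smul]
      gcongr
      have h2 : |c' x| ≤ 1 := le_of_tendsto hx.abs (Eventually.of_forall fun n => hc n x)
      calc ‖c n x - c' x‖ ≤ |c n x| + |c' x| := norm_sub_le _ _
        _ ≤ 1 + 1 := add_le_add (hc n x) h2
        _ = ‖(2 : ℝ)‖ := by norm_num
    · filter_upwards [hlim] with x hx
      simpa using (tendsto_sub_nhds_zero_iff.2 hx).smul_const (G' x)
  have h2 := hG.add h1
  rw [add_zero] at h2
  refine tendsto_of_tendsto_of_tendsto_of_le_of_le tendsto_const_nhds h2 (fun _ => zero_le)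
    fun n => ?_
  have h3 : (V n - V' : X → F) =ᵐ[ν] (fun x => c n x • (G n x - G' x)) +
      fun x => (c n x - c' x) • G' x := by
    filter_upwards [hV n, hV'] with x hx hx'
    simp only [Pi.sub_apply, Pi.add_apply, hx, hx', smul_sub, sub_smul]
    abel
  have hm1 : AEStronglyMeasurable (fun x => c n x • (G n x - G' x)) ν :=
    (hcm n).smul ((Lp.aestronglyMeasurable _).sub (Lp.aestronglyMeasurable _))
  have hm2 : AEStronglyMeasurable (fun x => (c n x - c' x) • G' x) ν :=
    ((hcm n).sub hcm').smul (Lp.aestronglyMeasurable G')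
  rw [eLpNorm_congr_ae h3]
  refine (eLpNorm_add_le hm1 hm2 (by norm_num)).trans ?_
  gcongr
  refine eLpNorm_mono fun x => ?_
  rw [norm_smul, Pi.sub_apply]
  exact mul_le_of_le_one_left (norm_nonneg _) (hc n x)

/-! ### Composition with smooth contractions -/

theorem lipschitz_of_abs_deriv_le_one {φ : ℝ → ℝ} (hφ : Differentiable ℝ φ)
    (h : ∀ t, |deriv φ t| ≤ 1) (s t : ℝ) : |φ s - φ t| ≤ |s - t| := by
  have := Convex.norm_image_sub_le_of_norm_deriv_le (s := univ) (f := φ) (C := 1)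
    (fun x _ => hφ x) (fun x _ => h x) convex_univ (mem_univ t) (mem_univ s)
  simpa using this

/-- The chain rule in `h10Pairs` for smooth contractions, with approximating test functions. -/
theorem exists_comp_pair {φ : ℝ → ℝ} (hφ : ContDiff ℝ ∞ φ) (h0 : φ 0 = 0)
    (h1 : ∀ t, |deriv φ t| ≤ 1) (w : h10Pairs m U) :
    ∃ (f : ℕ → Rn d → ℝ) (hf : ∀ n, IsTest U (f n)) (z : h10Pairs m U),
      Tendsto (fun n => (hf n).pair m) atTop (𝓝 w) ∧
      Tendsto (fun n => ((hf n).comp hφ h0).pair m) atTop (𝓝 z) ∧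
      (z.1.1 =ᵐ[m] fun x => φ (w.1.1 x)) ∧
      z.1.2 =ᵐ[m] fun x => deriv φ (w.1.1 x) • w.1.2 x := by
  obtain ⟨f, hf, hlim, hae, -⟩ := exists_pair_tendsto w
  have hφd : Differentiable ℝ φ := hφ.differentiable (by simp)
  have hφ' : Continuous (deriv φ) := hφ.continuous_deriv (by simp)
  have hm₁ : MemLp (fun x => φ (w.1.1 x)) 2 m :=
    (Lp.memLp w.1.1).of_le (hφ.continuous.comp_aestronglyMeasurable (Lp.aestronglyMeasurable _))
      (Eventually.of_forall fun x => by
        simpa [h0] using lipschitz_of_abs_deriv_le_one hφd h1 (w.1.1 x) 0)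
  have hm₂ : MemLp (fun x => deriv φ (w.1.1 x) • w.1.2 x) 2 m :=
    (Lp.memLp w.1.2).of_le ((hφ'.comp_aestronglyMeasurable (Lp.aestronglyMeasurable _)).smul
      (Lp.aestronglyMeasurable _)) (Eventually.of_forall fun x => by
        rw [norm_smul]
        exact mul_le_of_le_one_left (norm_nonneg _) (h1 _))
  have hfst : Tendsto (fun n => ((hf n).pair m).1.1) atTop (𝓝 w.1.1) :=
    (continuous_fst.comp continuous_subtype_val).tendsto w |>.comp hlim
  have hsnd : Tendsto (fun n => ((hf n).pair m).1.2) atTop (𝓝 w.1.2) :=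
    (continuous_snd.comp continuous_subtype_val).tendsto w |>.comp hlim
  have l₁ : Tendsto (fun n => (((hf n).comp hφ h0).pair m).1.1) atTop (𝓝 (hm₁.toLp _)) := by
    rw [tendsto_iff_norm_sub_tendsto_zero] at hfst ⊢
    refine squeeze_zero (fun _ => norm_nonneg _) (fun n => ?_) hfst
    refine Lp.norm_le_norm_of_ae_le ?_
    filter_upwards [Lp.coeFn_sub (((hf n).comp hφ h0).pair m).1.1 (hm₁.toLp _),
      Lp.coeFn_sub ((hf n).pair m).1.1 w.1.1, ((hf n).comp hφ h0).pair_fst (m := m),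
      (hf n).pair_fst (m := m), hm₁.coeFn_toLp] with x e1 e2 e3 e4 e5
    rw [e1, e2, Pi.sub_apply, Pi.sub_apply, e3, e4, e5]
    exact lipschitz_of_abs_deriv_le_one hφd h1 _ _
  -- No bound on `φ''` is assumed, so `φ'(fₙ)` is only known to converge almost everywhere. This
  -- suffices because the factors are bounded by `1` and the gradients converge in `L²`.
  have l₂ : Tendsto (fun n => (((hf n).comp hφ h0).pair m).1.2) atTop (𝓝 (hm₂.toLp _)) := by
    refine tendsto_toLp_smul (c := fun n x => deriv φ (f n x)) (fun n x => h1 _)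
      (fun n => (hφ'.comp (hf n).smooth.continuous).aestronglyMeasurable) ?_ hsnd (fun n => ?_)
      hm₂.coeFn_toLp
    · filter_upwards [hae] with x hx
      exact (hφ'.tendsto _).comp hx
    · filter_upwards [((hf n).comp hφ h0).pair_snd (m := m), (hf n).pair_snd (m := m)]
        with x e1 e2
      rw [e1, e2, gradient_comp_real hφd (hf n).differentiable]
  have l : Tendsto (fun n => (((hf n).comp hφ h0).pair m).1) atTop
      (𝓝 (hm₁.toLp _, hm₂.toLp _)) := l₁.prodMk_nhds l₂
  refine ⟨f, hf, ⟨_, isClosed_h10Pairs.mem_of_tendsto l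
    (Eventually.of_forall fun n => Subtype.mem _)⟩, hlim, tendsto_subtype_rng.2 l,
    hm₁.coeFn_toLp, hm₂.coeFn_toLp⟩

/-! ### Smooth approximations of the unit contraction -/

/-- Smooth functions on the line with values in `[0, 1]`, increasing to the indicator function of
`(0, 1)`. -/
def cutoffDeriv (k : ℕ) (t : ℝ) : ℝ :=
  Real.smoothTransition (k * t) * Real.smoothTransition (k * (1 - t))

/-- The primitive of `cutoffDeriv k` vanishing at `0`. -/
def smoothTruncation (k : ℕ) (t : ℝ) : ℝ := ∫ s in (0 : ℝ)..t, cutoffDeriv k s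

theorem contDiff_cutoffDeriv (k : ℕ) : ContDiff ℝ ∞ (cutoffDeriv k) := by
  unfold cutoffDeriv
  exact (Real.smoothTransition.contDiff.comp (by fun_prop)).mul
    (Real.smoothTransition.contDiff.comp (by fun_prop))

theorem abs_cutoffDeriv_le (k : ℕ) (t : ℝ) : |cutoffDeriv k t| ≤ 1 := by
  rw [cutoffDeriv, abs_of_nonneg (mul_nonneg (Real.smoothTransition.nonneg _)
    (Real.smoothTransition.nonneg _))]
  exact mul_le_one₀ (Real.smoothTransition.le_one _) (Real.smoothTransition.nonneg _)
    (Real.smoothTransition.le_one _)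

/-- For each `t` the sequence is eventually constant. It vanishes at the endpoints `0` and `1`, so
convergence holds at every point and the level sets `{u = 0}` and `{u = 1}` need no separate
treatment later. -/
theorem tendsto_cutoffDeriv (t : ℝ) :
    Tendsto (fun k => cutoffDeriv k t) atTop (𝓝 ((Ioo (0 : ℝ) 1).indicator 1 t)) := by
  have one : ∀ s : ℝ, 0 < s → ∀ᶠ k : ℕ in atTop, Real.smoothTransition (k * s) = 1 := by
    intro s hs
    obtain ⟨N, hN⟩ := exists_nat_ge (1 / s)
    filter_upwards [eventually_ge_atTop N] with k hk
    apply Real.smoothTransition.one_of_one_le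
    rw [← div_le_iff₀ hs]
    exact hN.trans (by exact_mod_cast hk)
  have zero : ∀ s : ℝ, s ≤ 0 → ∀ k : ℕ, Real.smoothTransition (k * s) = 0 := fun s hs k =>
    Real.smoothTransition.zero_of_nonpos (mul_nonpos_of_nonneg_of_nonpos k.cast_nonneg hs)
  refine tendsto_const_nhds.congr' ?_
  by_cases h0 : t ≤ 0
  · rw [indicator_of_notMem fun h => h.1.not_ge h0]
    exact Eventually.of_forall fun k => by simp [cutoffDeriv, zero t h0]
  by_cases h1 : 1 ≤ t
  · rw [indicator_of_notMem fun h => h.2.not_ge h1]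
    exact Eventually.of_forall fun k => by simp [cutoffDeriv, zero (1 - t) (by linarith)]
  push Not at h0 h1
  rw [indicator_of_mem (show t ∈ Ioo (0 : ℝ) 1 from ⟨h0, h1⟩)]
  filter_upwards [one t h0, one (1 - t) (by linarith)] with k h2 h3
  simp [cutoffDeriv, h2, h3]

theorem hasDerivAt_smoothTruncation (k : ℕ) (t : ℝ) :
    HasDerivAt (smoothTruncation k) (cutoffDeriv k t) t :=
  (contDiff_cutoffDeriv k).continuous.integral_hasStrictDerivAt 0 t |>.hasDerivAt

theorem deriv_smoothTruncation (k : ℕ) : deriv (smoothTruncation k) = cutoffDeriv k :=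
  funext fun t => (hasDerivAt_smoothTruncation k t).deriv

theorem contDiff_smoothTruncation (k : ℕ) : ContDiff ℝ ∞ (smoothTruncation k) :=
  contDiff_infty_iff_deriv.2 ⟨fun t => (hasDerivAt_smoothTruncation k t).differentiableAt, by
    rw [deriv_smoothTruncation]
    exact contDiff_cutoffDeriv k⟩

theorem smoothTruncation_zero (k : ℕ) : smoothTruncation k 0 = 0 :=
  intervalIntegral.integral_same

theorem abs_smoothTruncation_le (k : ℕ) (t : ℝ) : |smoothTruncation k t| ≤ |t| := by
  simpa [smoothTruncation_zero] using lipschitz_of_abs_deriv_le_one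
    (fun t => (hasDerivAt_smoothTruncation k t).differentiableAt)
    (by rw [deriv_smoothTruncation]; exact abs_cutoffDeriv_le k) t 0

theorem tendsto_smoothTruncation (t : ℝ) :
    Tendsto (fun k => smoothTruncation k t) atTop (𝓝 (min (max t 0) 1)) := by
  have h1 : Tendsto (fun k => smoothTruncation k t) atTop
      (𝓝 (∫ s in (0 : ℝ)..t, (Ioo (0 : ℝ) 1).indicator 1 s)) := by
    refine intervalIntegral.tendsto_integral_filter_of_dominated_convergence (fun _ => 1)
      (Eventually.of_forall fun k => (contDiff_cutoffDeriv k).continuous.aestronglyMeasurable)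
      (Eventually.of_forall fun k => Eventually.of_forall fun s _ => abs_cutoffDeriv_le k s)
      (by simp) (Eventually.of_forall fun s _ => tendsto_cutoffDeriv s)
  convert h1 using 2
  rcases le_or_gt t 0 with ht | ht
  · rw [intervalIntegral.integral_congr (g := fun _ => 0) fun s hs => ?_]
    · simp [ht]
    · rw [uIcc_of_ge ht] at hs
      exact indicator_of_notMem (fun h => h.1.not_ge hs.2) _
  · rw [intervalIntegral.integral_of_le ht.le,
      setIntegral_congr_set (Ioo_ae_eq_Ioc (a := (0 : ℝ)) (b := t)).symm,
      setIntegral_indicator measurableSet_Ioo, Ioo_inter_Ioo]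
    simp [ht.le]

end GradPairs

/-! ### Identification of `H₀^{1,2}` -/

section H10

variable {d : ℕ} {ρ : Rn d → ℝ} {B : Set (Rn d)}

/-- The representing element is `ρ⁻¹ ψ`. Lebesgue pairings with `ψ` are thus continuous on `L²(ρ
dx)`, so integration by parts passes to limits there. -/
theorem exists_inner_eq_setIntegral {F : Type*} [NormedAddCommGroup F] [InnerProductSpace ℝ F]
    (hc : Continuous ρ) (hpos : ∀ x, 0 < ρ x) (hb : Bornology.IsBounded B) (hB : MeasurableSet B)
    {ψ : Rn d → F} (hψ : Continuous ψ) (hψc : HasCompactSupport ψ) :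
    ∃ Ψ : Lp F 2 ((refMeasure ρ).restrict B), ∀ u : Lp F 2 ((refMeasure ρ).restrict B),
      inner ℝ Ψ u = ∫ x in B, inner ℝ (ψ x) (u x) := by
  have := isFiniteMeasure_refMeasure_restrict hc hpos hb hB
  have hm : MemLp (fun x => (ρ x)⁻¹ • ψ x) 2 ((refMeasure ρ).restrict B) :=
    ((hc.inv₀ fun x => (hpos x).ne').smul hψ).memLp_of_hasCompactSupport
      (hψc.smul_left (f := fun x => (ρ x)⁻¹))
  refine ⟨hm.toLp _, fun u => ?_⟩
  have h1 : inner ℝ (hm.toLp _) u =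
      ∫ x in B, inner ℝ ((ρ x)⁻¹ • ψ x) (u x) ∂(refMeasure ρ) := by
    rw [L2.inner_def]
    refine integral_congr_ae ?_
    filter_upwards [hm.coeFn_toLp] with x hx
    rw [hx]
  rw [h1, setIntegral_refMeasure hc hpos hB]
  refine integral_congr_ae (Eventually.of_forall fun x => ?_)
  simp only [inner_smul_left, smul_eq_mul]
  simp [mul_inv_cancel_left₀ (hpos x).ne']

theorem MemLp.locallyIntegrableOn_of_isBounded {F : Type*} [NormedAddCommGroup F]
    (hb : Bornology.IsBounded B) {f : Rn d → F} (hf : MemLp f 2 (volume.restrict B)) :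
    LocallyIntegrableOn f B volume := by
  have : IsFiniteMeasure ((volume : Measure (Rn d)).restrict B) := ⟨by
    simpa using hb.measure_lt_top⟩
  exact IntegrableOn.locallyIntegrableOn (hf.integrable (by norm_num))

/-- The second component of an element of `h10Pairs` is the weak gradient of the first. -/
theorem hasWeakGradient_of_h10Pairs (hc : Continuous ρ) (hpos : ∀ x, 0 < ρ x)
    (hb : Bornology.IsBounded B) (hB : IsOpen B)
    (w : h10Pairs ((refMeasure ρ).restrict B) B) : HasWeakGradient B w.1.1 w.1.2 := by
  have := isFiniteMeasure_refMeasure_restrict hc hpos hb hB.measurableSet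
  refine ⟨MemLp.locallyIntegrableOn_of_isBounded hb
    ((memLp_refMeasure_iff hc hpos hb hB.measurableSet).1 (Lp.memLp w.1.1)),
    MemLp.locallyIntegrableOn_of_isBounded hb
    ((memLp_refMeasure_iff hc hpos hb hB.measurableSet).1 (Lp.memLp w.1.2)), fun φ hφ i => ?_⟩
  have hae := ae_refMeasure_eq hc hpos hb hB.measurableSet
  obtain ⟨Ψ₁, h₁⟩ := exists_inner_eq_setIntegral (F := ℝ) hc hpos hb hB.measurableSet
    (ψ := fun x => gradient φ x i)
    ((EuclideanSpace.proj (𝕜 := ℝ) i).continuous.comp hφ.continuous_gradient)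
    (hφ.hasCompactSupport_gradient.comp_left (g := fun v : Rn d => v i) rfl)
  obtain ⟨Ψ₂, h₂⟩ := exists_inner_eq_setIntegral (F := Rn d) hc hpos hb hB.measurableSet
    (ψ := fun x => φ x • EuclideanSpace.single i (1 : ℝ))
    (hφ.smooth.continuous.smul continuous_const) hφ.compact.smul_right
  have e₁ : ∀ u : Lp ℝ 2 ((refMeasure ρ).restrict B),
      inner ℝ Ψ₁ u = ∫ x in B, u x * gradient φ x i := fun u => by rw [h₁]; rfl
  have e₂ : ∀ G : Lp (Rn d) 2 ((refMeasure ρ).restrict B),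
      inner ℝ Ψ₂ G = ∫ x in B, G x i * φ x := fun G => by
    rw [h₂]
    refine integral_congr_ae (Eventually.of_forall fun x => ?_)
    simp [inner_smul_left, EuclideanSpace.inner_single_left, mul_comm]
  obtain ⟨f, hf, hlim, -, -⟩ := exists_pair_tendsto w
  have l₁ : Tendsto (fun n => inner ℝ Ψ₁ ((hf n).pair ((refMeasure ρ).restrict B)).1.1) atTop
      (𝓝 (inner ℝ Ψ₁ w.1.1)) :=
    ((continuous_const.inner (continuous_fst.comp continuous_subtype_val)).tendsto w).comp hlim
  have l₂ : Tendsto (fun n => inner ℝ Ψ₂ ((hf n).pair ((refMeasure ρ).restrict B)).1.2) atTop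
      (𝓝 (inner ℝ Ψ₂ w.1.2)) :=
    ((continuous_const.inner (continuous_snd.comp continuous_subtype_val)).tendsto w).comp hlim
  rw [← e₁, ← e₂]
  refine tendsto_nhds_unique l₁ (l₂.neg.congr fun n => ?_)
  rw [e₁, e₂]
  have a₁ := (hf n).pair_fst (m := (refMeasure ρ).restrict B)
  have a₂ := (hf n).pair_snd (m := (refMeasure ρ).restrict B)
  rw [EventuallyEq, hae] at a₁ a₂
  rw [integral_congr_ae (g := fun x => gradient (f n) x i * φ x)
      (by filter_upwards [a₂] with x hx; rw [hx]), ← (hf n).setIntegral_mul_gradient hφ i]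
  exact integral_congr_ae (by filter_upwards [a₁] with x hx; rw [hx])

theorem HasWeakGradient.congr {f g : Rn d → ℝ} {G : Rn d → Rn d} (hf : HasWeakGradient B f G)
    (hfg : g =ᵐ[volume.restrict B] f)
    (hg : LocallyIntegrableOn g B volume) : HasWeakGradient B g G :=
  ⟨hg, hf.locIntGrad, fun φ hφ i => by
    rw [← hf.integral_eq φ hφ i]
    exact integral_congr_ae (by filter_upwards [hfg] with x hx; rw [hx])⟩

/-- Approximation in `H^{1,2}(B)` by test functions is convergence of the pairs `(φₙ, ∇φₙ)` in the
product of the two `L²` spaces, whichever of the comparable measures is used. -/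
theorem memH10_iff (hc : Continuous ρ) (hpos : ∀ x, 0 < ρ x) (hb : Bornology.IsBounded B)
    (hB : IsOpen B) {u : Rn d → ℝ} : MemH10 B u ↔
      ∃ w : h10Pairs ((refMeasure ρ).restrict B) B, w.1.1 =ᵐ[(refMeasure ρ).restrict B] u := by
  have := isFiniteMeasure_refMeasure_restrict hc hpos hb hB.measurableSet
  have hae := ae_refMeasure_eq hc hpos hb hB.measurableSet
  constructor
  · rintro ⟨G, -, hu, hG, φ, hφ, l₁, l₂⟩
    rw [← memLp_refMeasure_iff hc hpos hb hB.measurableSet] at hu hG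
    rw [← tendsto_eLpNorm_refMeasure_iff hc hpos hb hB.measurableSet] at l₁ l₂
    have m₁ : Tendsto (fun n => ((hφ n).pair ((refMeasure ρ).restrict B)).1.1) atTop
        (𝓝 (hu.toLp u)) := by
      refine (Lp.tendsto_Lp_iff_tendsto_eLpNorm'' φ (fun n => (hφ n).memLp 2 _) u hu).2 ?_
      exact l₁.congr fun n => eLpNorm_sub_comm u (φ n) _ _
    have m₂ : Tendsto (fun n => ((hφ n).pair ((refMeasure ρ).restrict B)).1.2) atTop
        (𝓝 (hG.toLp G)) := by
      refine (Lp.tendsto_Lp_iff_tendsto_eLpNorm'' (fun n => gradient (φ n))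
        (fun n => (hφ n).memLp_gradient 2 _) G hG).2 ?_
      exact l₂.congr fun n => eLpNorm_sub_comm G (gradient (φ n)) _ _
    exact ⟨⟨_, isClosed_h10Pairs.mem_of_tendsto (m₁.prodMk_nhds m₂)
      (Eventually.of_forall fun n => ((hφ n).pair _).2)⟩, hu.coeFn_toLp⟩
  · rintro ⟨w, hw⟩
    have hw' : u =ᵐ[volume.restrict B] w.1.1 := by
      rw [EventuallyEq, ← hae]
      exact hw.symm
    have hwu := (memLp_refMeasure_iff hc hpos hb hB.measurableSet).1 (Lp.memLp w.1.1)
    have hu : MemLp u 2 (volume.restrict B) := (memLp_congr_ae hw').2 hwu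
    have hG := (memLp_refMeasure_iff hc hpos hb hB.measurableSet).1 (Lp.memLp w.1.2)
    obtain ⟨φ, hφ, hlim, -, -⟩ := exists_pair_tendsto w
    refine ⟨w.1.2, (hasWeakGradient_of_h10Pairs hc hpos hb hB w).congr hw'
      (MemLp.locallyIntegrableOn_of_isBounded hb hu), hu, hG, φ, hφ, ?_, ?_⟩
    · rw [← tendsto_eLpNorm_refMeasure_iff hc hpos hb hB.measurableSet]
      have := (continuous_fst.comp continuous_subtype_val).tendsto w |>.comp hlim
      refine ((Lp.tendsto_Lp_iff_tendsto_eLpNorm' _ _).1 this).congr fun n => ?_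
      rw [eLpNorm_sub_comm]
      refine eLpNorm_congr_ae ?_
      filter_upwards [hw, (hφ n).pair_fst (m := (refMeasure ρ).restrict B)] with x e₁ e₂
      rw [← e₁, ← e₂]
      rfl
    · rw [← tendsto_eLpNorm_refMeasure_iff hc hpos hb hB.measurableSet]
      have := (continuous_snd.comp continuous_subtype_val).tendsto w |>.comp hlim
      refine ((Lp.tendsto_Lp_iff_tendsto_eLpNorm' _ _).1 this).congr fun n => ?_
      rw [eLpNorm_sub_comm]
      refine eLpNorm_congr_ae ?_
      filter_upwards [(hφ n).pair_snd (m := (refMeasure ρ).restrict B)] with x e₂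
      rw [← e₂]
      rfl

/-- The second component is a weak gradient of the first, and the weak gradient of `0` is unique. -/
theorem h10Pairs_graph (hc : Continuous ρ) (hpos : ∀ x, 0 < ρ x) (hb : Bornology.IsBounded B)
    (hB : IsOpen B) (w : h10Pairs ((refMeasure ρ).restrict B) B) (hw : w.1.1 = 0) : w = 0 := by
  have hae := ae_refMeasure_eq hc hpos hb hB.measurableSet
  have h := (hasWeakGradient_of_h10Pairs hc hpos hb hB w).ae_eq hB
    (hasWeakGradient_of_h10Pairs hc hpos hb hB 0) (by rw [hw]; rfl)
  rw [EventuallyEq, ← hae] at h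
  exact Subtype.ext (Prod.ext hw (Lp.ext h))

/-- `C₀^∞(B)` is dense in `L²(B, ρ dx)`. -/
theorem dense_testSubmodule (hc : Continuous ρ) (hpos : ∀ x, 0 < ρ x)
    (hb : Bornology.IsBounded B) (hB : IsOpen B) :
    Dense (testSubmodule (refMeasure ρ) B : Set (Lp ℝ 2 ((refMeasure ρ).restrict B))) := by
  have := isFiniteMeasure_refMeasure_restrict hc hpos hb hB.measurableSet
  have hae := ae_refMeasure_eq hc hpos hb hB.measurableSet
  rw [Submodule.dense_iff_topologicalClosure_eq_top, Submodule.topologicalClosure_eq_top_iff,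
    Submodule.eq_bot_iff]
  intro h hh
  have hL : MemLp h 2 (volume.restrict B) :=
    (memLp_refMeasure_iff hc hpos hb hB.measurableSet).1 (Lp.memLp h)
  -- If `h` is orthogonal to all test functions in `L²(ρ dx)`, then `ρ h` annihilates them for
  -- Lebesgue measure.
  have h1 := hB.ae_eq_zero_of_integral_contDiff_smul_eq_zero
    (f := fun x => ρ x * h x) (μ := volume)
    ((MemLp.locallyIntegrableOn_of_isBounded hb hL).continuousOn_mul hc.continuousOn
      hB.isLocallyClosed) (fun φ h₁ h₂ h₃ => by
        have hφ : IsTest B φ := ⟨h₁, h₂, h₃⟩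
        have h2 := hh ((hφ.memLp 2 ((refMeasure ρ).restrict B)).toLp φ)
          ⟨φ, hφ, MemLp.coeFn_toLp _⟩
        rw [L2.inner_def, integral_congr_ae (g := fun x => φ x * h x) (by
          filter_upwards [(hφ.memLp 2 ((refMeasure ρ).restrict B)).coeFn_toLp] with x hx
          rw [hx]
          exact mul_comm _ _), setIntegral_refMeasure hc hpos hB.measurableSet] at h2
        rw [← setIntegral_eq_integral_of_forall_compl_eq_zero
          (s := B) fun x hx => by simp [hφ.eq_zero hx], ← h2]
        refine integral_congr_ae (Eventually.of_forall fun x => ?_)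
        simp only [smul_eq_mul]
        ring)
  refine Lp.ext ?_
  rw [EventuallyEq, hae, ae_restrict_iff' hB.measurableSet]
  have h0 : ∀ᵐ x ∂(volume : Measure (Rn d)).restrict B,
      (0 : Lp ℝ 2 ((refMeasure ρ).restrict B)) x = 0 := by
    rw [← hae]
    exact Lp.coeFn_zero _ _ _
  filter_upwards [h1, (ae_restrict_iff' hB.measurableSet).1 h0] with x hx hx0 hxB
  rw [hx0 hxB]
  exact (mul_eq_zero.1 (hx hxB)).resolve_left (hpos x).ne'

/-! ### The Sobolev bound for the drift -/

/-- The Gagliardo–Nirenberg–Sobolev inequality with `q = 2d/(d-2)`. The relation `1/q + 1/d = 1/2`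
is also the Hölder relation pairing `L^q` functions with `L^d` drifts. -/
theorem exists_sobolev (hd : 3 ≤ d) : ∃ q C : NNReal, ENNReal.HolderTriple q d 2 ∧
    ∀ f : Rn d → ℝ, IsTest B f → eLpNorm f q volume ≤ C * eLpNorm (gradient f) 2 volume := by
  have hd' : (3 : ℝ) ≤ d := by exact_mod_cast hd
  have hpos : (0 : ℝ) < 2⁻¹ - (d : ℝ)⁻¹ := by
    have : (d : ℝ)⁻¹ ≤ 3⁻¹ := inv_anti₀ (by norm_num) hd'
    linarith [show (3 : ℝ)⁻¹ < 2⁻¹ by norm_num]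
  set q : NNReal := (2⁻¹ - (d : ℝ)⁻¹)⁻¹.toNNReal with hq
  have hqr : (q : ℝ)⁻¹ = 2⁻¹ - (d : ℝ)⁻¹ := by
    rw [hq, Real.coe_toNNReal _ (inv_nonneg.2 hpos.le), inv_inv]
  have hq0 : q ≠ 0 := fun h => by
    rw [h] at hqr
    simp only [NNReal.coe_zero, inv_zero] at hqr
    linarith
  refine ⟨q, SNormLESNormFDerivOfEqConst ℝ (volume : Measure (Rn d)) ((2 : NNReal) : ℝ), ⟨?_⟩,
    fun f hf => ?_⟩
  · have h1 : q⁻¹ + (d : NNReal)⁻¹ = 2⁻¹ := by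
      apply NNReal.eq
      push_cast
      rw [hqr]
      ring
    have h2 : (d : NNReal) ≠ 0 := by
      have : d ≠ 0 := by omega
      exact_mod_cast this
    have h3 := congrArg (fun x : NNReal => (x : ℝ≥0∞)) h1
    simpa [ENNReal.coe_inv hq0, ENNReal.coe_inv h2] using h3
  · have := eLpNorm_le_eLpNorm_fderiv_of_eq (volume : Measure (Rn d)) (u := f) (p := 2) (p' := q)
      (hf.smooth.of_le (by norm_cast)) hf.compact (by norm_num)
      (by rw [finrank_euclideanSpace_fin]; omega) (by simpa using hqr)
    rw [eLpNorm_congr_norm_ae (g := fderiv ℝ f)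
      (Eventually.of_forall fun x => norm_gradient_eq f x)]
    exact this

/-- Hölder is applied for `m` and Sobolev for Lebesgue measure, so the comparison constant `K`
enters once in each direction. -/
theorem eLpNorm_smul_le_of_sobolev {m : Measure (Rn d)} {q K C : ℝ≥0∞} {s : ℝ≥0∞}
    (hq : ENNReal.HolderTriple q s 2) (h₁ : m ≤ K • volume.restrict B)
    (h₂ : volume.restrict B ≤ K • m) {f : Rn d → ℝ} (hf : IsTest B f)
    (hS : eLpNorm f q volume ≤ C * eLpNorm (gradient f) 2 volume) {b : Rn d → Rn d}
    (hb : AEStronglyMeasurable b m) :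
    eLpNorm (fun x => f x • b x) 2 m ≤
      K ^ (1 / q).toReal * C * K ^ (1 / (2 : ℝ≥0∞)).toReal * eLpNorm b s m *
        eLpNorm (gradient f) 2 m := by
  have e₁ : eLpNorm f q m ≤ K ^ (1 / q).toReal * eLpNorm f q volume := by
    refine (eLpNorm_le_of_measure_le_smul h₁).trans ?_
    rw [smul_eq_mul]
    exact mul_le_mul_right (eLpNorm_mono_measure f Measure.restrict_le_self) _
  have e₂ : eLpNorm (gradient f) 2 volume ≤
      K ^ (1 / (2 : ℝ≥0∞)).toReal * eLpNorm (gradient f) 2 m := by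
    rw [← eLpNorm_restrict_eq_of_support_subset (s := B) fun x hx => by_contra fun h =>
      hx (hf.gradient_eq_zero h)]
    exact eLpNorm_le_of_measure_le_smul h₂
  have e₃ : eLpNorm (fun x => f x • b x) 2 m ≤ eLpNorm f q m * eLpNorm b s m :=
    eLpNorm_smul_le_mul_eLpNorm (f := b) (φ := f) hb hf.smooth.continuous.aestronglyMeasurable
  calc eLpNorm (fun x => f x • b x) 2 m ≤ eLpNorm f q m * eLpNorm b s m := e₃
    _ ≤ (K ^ (1 / q).toReal * (C * (K ^ (1 / (2 : ℝ≥0∞)).toReal *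
          eLpNorm (gradient f) 2 m))) * eLpNorm b s m := by
        gcongr
        exact e₁.trans (by gcongr; exact hS.trans (by gcongr))
    _ = _ := by ring

theorem exists_drift_bound (hd : 3 ≤ d) (hc : Continuous ρ) (hpos : ∀ x, 0 < ρ x)
    (hb : Bornology.IsBounded B) (hB : IsOpen B) {b : Rn d → Rn d}
    (hbm : MemLp b d ((refMeasure ρ).restrict B)) :
    ∃ C : ℝ≥0∞, C ≠ ⊤ ∧ ∀ f : Rn d → ℝ, IsTest B f →
      eLpNorm (fun x => f x • b x) 2 ((refMeasure ρ).restrict B) ≤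
        C * eLpNorm (gradient f) 2 ((refMeasure ρ).restrict B) := by
  obtain ⟨q, C, hq, hS⟩ := exists_sobolev (B := B) hd
  obtain ⟨K, hK, h₁, h₂⟩ := exists_refMeasure_comparable hc hpos hb hB.measurableSet
  have hKp : ∀ s : ℝ≥0∞, K ^ (1 / s).toReal ≠ ⊤ := fun s =>
    ENNReal.rpow_ne_top_of_nonneg ENNReal.toReal_nonneg hK
  exact ⟨_, ENNReal.mul_ne_top (ENNReal.mul_ne_top (ENNReal.mul_ne_top (hKp _)
    ENNReal.coe_ne_top) (hKp _)) hbm.eLpNorm_ne_top, fun f hf =>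
    eLpNorm_smul_le_of_sobolev hq h₁ h₂ hf (hS f hf) hbm.1⟩

/-- Multiplication by a vector field `b`, from `h10Pairs` to `L²`. -/
theorem exists_drift_clm {m : Measure (Rn d)} [IsFiniteMeasure m] {b : Rn d → Rn d}
    (hbm : AEStronglyMeasurable b m) {C : ℝ≥0∞} (hC : C ≠ ⊤)
    (hbd : ∀ f : Rn d → ℝ, IsTest B f →
      eLpNorm (fun x => f x • b x) 2 m ≤ C * eLpNorm (gradient f) 2 m) :
    ∃ L : h10Pairs m B →L[ℝ] Lp (Rn d) 2 m, (∀ w, L w =ᵐ[m] fun x => w.1.1 x • b x) ∧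
      ∀ w, ‖L w‖ ≤ C.toReal * ‖w.1.2‖ := by
  have h1 : ∀ w : h10Pairs m B, eLpNorm (fun x => w.1.1 x • b x) 2 m ≤ C * ‖w.1.2‖ₑ := by
    intro w
    obtain ⟨f, hf, hlim, hae, -⟩ := exists_pair_tendsto w
    -- Fatou's lemma extends the bound from test functions, since only almost everywhere convergence
    -- of `fₙ b` is available at this point.
    have h2 : eLpNorm (fun x => w.1.1 x • b x) 2 m ≤
        liminf (fun n => eLpNorm (fun x => f n x • b x) 2 m) atTop := by
      refine Lp.eLpNorm_lim_le_liminf_eLpNorm (fun n =>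
        (hf n).smooth.continuous.aestronglyMeasurable.smul hbm) _ ?_
      filter_upwards [hae] with x hx
      exact hx.smul_const _
    have h3 : Tendsto (fun n => C * ‖((hf n).pair m).1.2‖ₑ) atTop (𝓝 (C * ‖w.1.2‖ₑ)) :=
      ENNReal.Tendsto.const_mul
        ((continuous_snd.comp continuous_subtype_val).tendsto w |>.comp hlim).enorm (Or.inr hC)
    rw [← h3.liminf_eq]
    refine h2.trans (liminf_le_liminf (Eventually.of_forall fun n => ?_))
    refine (hbd _ (hf n)).trans_eq ?_
    rw [Lp.enorm_def, eLpNorm_congr_ae (hf n).pair_snd]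
  have h2 : ∀ w : h10Pairs m B, MemLp (fun x => w.1.1 x • b x) 2 m := fun w =>
    ⟨(Lp.aestronglyMeasurable w.1.1).smul hbm,
      (h1 w).trans_lt (ENNReal.mul_lt_top hC.lt_top (by simp))⟩
  have h3 : ∀ w : h10Pairs m B, ‖(h2 w).toLp _‖ ≤ C.toReal * ‖w.1.2‖ := fun w => by
    rw [Lp.norm_toLp, ← toReal_enorm, ← ENNReal.toReal_mul]
    exact ENNReal.toReal_mono (ENNReal.mul_ne_top hC (by simp)) (h1 w)
  let L : h10Pairs m B →ₗ[ℝ] Lp (Rn d) 2 m :=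
    { toFun := fun w => (h2 w).toLp _
      map_add' := fun w z => by
        rw [← MemLp.toLp_add, MemLp.toLp_eq_toLp_iff]
        filter_upwards [Lp.coeFn_add w.1.1 z.1.1] with x hx
        change (w.1.1 + z.1.1 : Lp ℝ 2 m) x • b x = _
        rw [hx, Pi.add_apply, add_smul]
        rfl
      map_smul' := fun c w => by
        rw [RingHom.id_apply, ← MemLp.toLp_const_smul, MemLp.toLp_eq_toLp_iff]
        filter_upwards [Lp.coeFn_smul c w.1.1] with x hx
        change (c • w.1.1 : Lp ℝ 2 m) x • b x = _
        rw [hx, Pi.smul_apply, smul_assoc]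
        rfl }
  refine ⟨L.mkContinuous C.toReal fun w => (h3 w).trans ?_, fun w => (h2 w).coeFn_toLp,
    h3⟩
  gcongr
  exact le_max_right _ _

/-! ### Matrix fields -/

/-- Cauchy–Schwarz in each row bounds every squared coordinate by `d K² ‖ξ‖²`; summing over `d` rows
gives the factor `d K`. -/
theorem norm_matVec_le {M : Matrix (Fin d) (Fin d) ℝ} {K : ℝ} (hK : 0 ≤ K)
    (h : ∀ i j, |M i j| ≤ K) (ξ : Rn d) : ‖matVec M ξ‖ ≤ d * K * ‖ξ‖ := by
  have h1 : ∀ i, (matVec M ξ i) ^ 2 ≤ d * K ^ 2 * ‖ξ‖ ^ 2 := fun i => by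
    have e : matVec M ξ i = ∑ j, M i j * ξ j := rfl
    rw [e, EuclideanSpace.norm_sq_eq]
    refine (Finset.sum_mul_sq_le_sq_mul_sq _ _ _).trans ?_
    simp only [Real.norm_eq_abs, sq_abs]
    gcongr
    calc ∑ j, M i j ^ 2 ≤ ∑ _j : Fin d, K ^ 2 := Finset.sum_le_sum fun j _ => by
          rw [← sq_abs]
          gcongr
          exact h i j
      _ = d * K ^ 2 := by simp
  have h2 : ‖matVec M ξ‖ ^ 2 ≤ (d * K * ‖ξ‖) ^ 2 := by
    rw [EuclideanSpace.norm_sq_eq]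
    calc ∑ i, ‖matVec M ξ i‖ ^ 2 ≤ ∑ _i : Fin d, d * K ^ 2 * ‖ξ‖ ^ 2 :=
          Finset.sum_le_sum fun i _ => by
            rw [Real.norm_eq_abs, sq_abs]
            exact h1 i
      _ = _ := by simp; ring
  exact (sq_le_sq₀ (norm_nonneg _) (by positivity)).1 h2

theorem aestronglyMeasurable_matVec {m : Measure (Rn d)} {A : Rn d → Matrix (Fin d) (Fin d) ℝ}
    (hA : ∀ i j, AEStronglyMeasurable (fun x => A x i j) m) {F : Rn d → Rn d}
    (hF : AEStronglyMeasurable F m) : AEStronglyMeasurable (fun x => matVec (A x) (F x)) m := by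
  have h1 : ∀ j, AEStronglyMeasurable (fun x => F x j) m := fun j =>
    (EuclideanSpace.proj (𝕜 := ℝ) j).continuous.comp_aestronglyMeasurable hF
  have h2 : AEStronglyMeasurable (fun x => A x *ᵥ (F x : Fin d → ℝ)) m := by
    refine (aemeasurable_pi_lambda _ fun i => ?_).aestronglyMeasurable
    exact Finset.aemeasurable_fun_sum Finset.univ fun j _ =>
      (hA i j).aemeasurable.mul (h1 j).aemeasurable
  exact (PiLp.continuous_toLp 2 fun _ : Fin d => ℝ).comp_aestronglyMeasurable h2

theorem matVec_add (M : Matrix (Fin d) (Fin d) ℝ) (ξ η : Rn d) :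
    matVec M (ξ + η) = matVec M ξ + matVec M η := by
  simp [matVec, Matrix.mulVec_add]

theorem matVec_smul (M : Matrix (Fin d) (Fin d) ℝ) (c : ℝ) (ξ : Rn d) :
    matVec M (c • ξ) = c • matVec M ξ := by
  simp [matVec, Matrix.mulVec_smul]

/-- Multiplication by a bounded matrix field on `L²`. -/
theorem exists_matVec_clm {m : Measure (Rn d)} {A : Rn d → Matrix (Fin d) (Fin d) ℝ}
    (hA : ∀ i j, AEStronglyMeasurable (fun x => A x i j) m) {K : ℝ} (hK : 0 ≤ K)
    (hbd : ∀ᵐ x ∂m, ∀ i j, |A x i j| ≤ K) :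
    ∃ L : Lp (Rn d) 2 m →L[ℝ] Lp (Rn d) 2 m, ∀ F, L F =ᵐ[m] fun x => matVec (A x) (F x) := by
  have h1 : ∀ F : Lp (Rn d) 2 m, ∀ᵐ x ∂m, ‖matVec (A x) (F x)‖ ≤ d * K * ‖F x‖ := fun F => by
    filter_upwards [hbd] with x hx
    exact norm_matVec_le hK hx _
  have h2 : ∀ F : Lp (Rn d) 2 m, MemLp (fun x => matVec (A x) (F x)) 2 m := fun F =>
    (Lp.memLp F).of_le_mul (aestronglyMeasurable_matVec hA (Lp.aestronglyMeasurable F)) (h1 F)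
  let L : Lp (Rn d) 2 m →ₗ[ℝ] Lp (Rn d) 2 m :=
    { toFun := fun F => (h2 F).toLp _
      map_add' := fun F G => by
        rw [← MemLp.toLp_add, MemLp.toLp_eq_toLp_iff]
        filter_upwards [Lp.coeFn_add F G] with x hx
        rw [hx, Pi.add_apply, matVec_add]
        rfl
      map_smul' := fun c F => by
        rw [RingHom.id_apply, ← MemLp.toLp_const_smul, MemLp.toLp_eq_toLp_iff]
        filter_upwards [Lp.coeFn_smul c F] with x hx
        rw [hx, Pi.smul_apply, matVec_smul]
        rfl }
  refine ⟨L.mkContinuous (d * K) fun F => ?_, fun F => (h2 F).coeFn_toLp⟩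
  refine Lp.norm_le_mul_norm_of_ae_le_mul ?_
  filter_upwards [h1 F, (h2 F).coeFn_toLp] with x hx e
  change ‖(h2 F).toLp _ x‖ ≤ _
  rw [e]
  exact hx

end H10

/-! ### The diffusion and drift parts of the form -/

section Forms

variable {d : ℕ} {A : Rn d → Matrix (Fin d) (Fin d) ℝ} {H : Rn d → Rn d} {p : ℝ}
  {ρ : Rn d → ℝ} {Dρ : Rn d → Rn d} {B : Set (Rn d)}

/-- The difference of two continuous bilinear forms. -/
def bilinSub {W : Type*} [NormedAddCommGroup W] [NormedSpace ℝ W] (P N : W →L[ℝ] W →L[ℝ] ℝ) :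
    W →L[ℝ] W →L[ℝ] ℝ := P - N

theorem bilinSub_apply {W : Type*} [NormedAddCommGroup W] [NormedSpace ℝ W]
    (P N : W →L[ℝ] W →L[ℝ] ℝ) (w z : W) : bilinSub P N w z = P w z - N w z := rfl

/-- `P` and `N` are the continuous bilinear forms `∫ ⟨A∇u, ∇v⟩ dm` and `∫ ⟨b, ∇u⟩ v dm`, both
bounded by a multiple of `‖∇u‖ ‖∇v‖`. -/
structure IsFormPair (m : Measure (Rn d)) (B : Set (Rn d)) (A : Rn d → Matrix (Fin d) (Fin d) ℝ)
    (b : Rn d → Rn d) (P N : h10Pairs m B →L[ℝ] h10Pairs m B →L[ℝ] ℝ) : Prop where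
  integrable_left : ∀ w z : h10Pairs m B,
    Integrable (fun x => inner ℝ (matVec (A x) (w.1.2 x)) (z.1.2 x)) m
  integrable_right : ∀ w z : h10Pairs m B,
    Integrable (fun x => inner ℝ (b x) (w.1.2 x) * z.1.1 x) m
  left_eq : ∀ w z : h10Pairs m B, P w z = ∫ x, inner ℝ (matVec (A x) (w.1.2 x)) (z.1.2 x) ∂m
  right_eq : ∀ w z : h10Pairs m B, N w z = ∫ x, inner ℝ (b x) (w.1.2 x) * z.1.1 x ∂m
  bound : ∃ C : ℝ, 0 < C ∧ ∀ w z : h10Pairs m B, |P w z - N w z| ≤ C * ‖w.1.2‖ * ‖z.1.2‖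

/-- The drift integrand is rewritten as `⟨∇u, v b⟩`, so that the field multiplies the
undifferentiated factor `v`, where `‖v b‖₂ ≤ C ‖∇v‖₂` applies. -/
theorem exists_isFormPair {m : Measure (Rn d)} [IsFiniteMeasure m] {b : Rn d → Rn d}
    (hA : ∀ i j, AEStronglyMeasurable (fun x => A x i j) m) {K : ℝ} (hK : 0 ≤ K)
    (hAbd : ∀ᵐ x ∂m, ∀ i j, |A x i j| ≤ K) (hbm : AEStronglyMeasurable b m) {C : ℝ≥0∞}
    (hC : C ≠ ⊤) (hbd : ∀ f : Rn d → ℝ, IsTest B f →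
      eLpNorm (fun x => f x • b x) 2 m ≤ C * eLpNorm (gradient f) 2 m) :
    ∃ P N, IsFormPair m B A b P N := by
  obtain ⟨LA, hLA⟩ := exists_matVec_clm hA hK hAbd
  obtain ⟨Lb, hLb, hLbn⟩ := exists_drift_clm hbm hC hbd
  let S : h10Pairs m B →L[ℝ] Lp (Rn d) 2 m :=
    (ContinuousLinearMap.snd ℝ (Lp ℝ 2 m) (Lp (Rn d) 2 m)).comp (h10Pairs m B).subtypeL
  have e₁ : ∀ w z : h10Pairs m B, (fun x => inner ℝ (LA w.1.2 x) (z.1.2 x)) =ᵐ[m]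
      fun x => inner ℝ (matVec (A x) (w.1.2 x)) (z.1.2 x) := fun w z => by
    filter_upwards [hLA w.1.2] with x hx
    rw [hx]
  have e₂ : ∀ w z : h10Pairs m B, (fun x => inner ℝ (w.1.2 x) (Lb z x)) =ᵐ[m]
      fun x => inner ℝ (b x) (w.1.2 x) * z.1.1 x := fun w z => by
    filter_upwards [hLb z] with x hx
    rw [hx, inner_smul_right, real_inner_comm, mul_comm]
  refine ⟨(innerSL ℝ).bilinearComp (LA.comp S) S, (innerSL ℝ).bilinearComp S Lb,
    fun w z => (L2.integrable_inner _ _).congr (e₁ w z),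
    fun w z => (L2.integrable_inner _ _).congr (e₂ w z), fun w z => ?_, fun w z => ?_,
    ‖LA‖ + C.toReal + 1, by positivity, fun w z => ?_⟩
  · exact (L2.inner_def (𝕜 := ℝ) (LA w.1.2) z.1.2).trans (integral_congr_ae (e₁ w z))
  · exact (L2.inner_def (𝕜 := ℝ) w.1.2 (Lb z)).trans (integral_congr_ae (e₂ w z))
  · change |inner ℝ (LA w.1.2) z.1.2 - inner ℝ w.1.2 (Lb z)| ≤ _
    calc |inner ℝ (LA w.1.2) z.1.2 - inner ℝ w.1.2 (Lb z)|
        ≤ |inner ℝ (LA w.1.2) z.1.2| + |inner ℝ w.1.2 (Lb z)| := abs_sub _ _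
      _ ≤ ‖LA w.1.2‖ * ‖z.1.2‖ + ‖w.1.2‖ * ‖Lb z‖ :=
          add_le_add (abs_real_inner_le_norm _ _) (abs_real_inner_le_norm _ _)
      _ ≤ ‖LA‖ * ‖w.1.2‖ * ‖z.1.2‖ + ‖w.1.2‖ * (C.toReal * ‖z.1.2‖) := by
          gcongr
          · exact LA.le_opNorm _
          · exact hLbn z
      _ ≤ _ := by
          have := mul_nonneg (norm_nonneg w.1.2) (norm_nonneg z.1.2)
          linarith

/-! ### Positivity of the diffusion part, vanishing of the drift part, and the unit contraction. -/

namespace IsFormPair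

variable {m : Measure (Rn d)} {b : Rn d → Rn d} {P N : h10Pairs m B →L[ℝ] h10Pairs m B →L[ℝ] ℝ}

/-- Intended for `u` and `v` whose gradients are nonnegative multiples of one gradient `∇w`: the
integrand is then `c₁ c₂ ⟨A∇w, ∇w⟩`. -/
theorem left_nonneg (h : IsFormPair m B A b P N)
    (hell : ∀ᵐ x ∂m, ∀ ξ : Rn d, 0 ≤ inner ℝ (matVec (A x) ξ) ξ) {w u v : h10Pairs m B}
    {c₁ c₂ : Rn d → ℝ} (h₁ : ∀ x, 0 ≤ c₁ x) (h₂ : ∀ x, 0 ≤ c₂ x)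
    (hu : u.1.2 =ᵐ[m] fun x => c₁ x • w.1.2 x) (hv : v.1.2 =ᵐ[m] fun x => c₂ x • w.1.2 x) :
    0 ≤ P u v := by
  rw [h.left_eq]
  refine integral_nonneg_of_ae ?_
  filter_upwards [hell, hu, hv] with x hx e₁ e₂
  rw [e₁, e₂, matVec_smul, inner_smul_left, inner_smul_right]
  exact mul_nonneg (h₁ x) (mul_nonneg (h₂ x) (hx _))

theorem coercive (h : IsFormPair m B A b P N) {c : ℝ}
    (hell : ∀ᵐ x ∂m, ∀ ξ : Rn d, c * ‖ξ‖ ^ 2 ≤ inner ℝ (matVec (A x) ξ) ξ) (w : h10Pairs m B) :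
    c * ‖w.1.2‖ ^ 2 ≤ P w w := by
  rw [h.left_eq, ← real_inner_self_eq_norm_sq, L2.inner_def, ← integral_const_mul]
  refine integral_mono_ae ((L2.integrable_inner _ _).const_mul c) (h.integrable_left w w) ?_
  filter_upwards [hell] with x hx
  rw [real_inner_self_eq_norm_sq]
  exact hx _

variable [IsFiniteMeasure m]

/-- The same test functions `fₙ` approximate `w` and, after composition with `φ`, the chain rule
limit `z`. Continuity of `N` then preserves `N(fₙ, φ(fₙ)) = 0`. -/
theorem right_comp_eq_zero (hN : ∀ (f : Rn d → ℝ) (hf : IsTest B f) (φ : ℝ → ℝ)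
      (hφ : ContDiff ℝ ∞ φ) (h0 : φ 0 = 0), N (hf.pair m) ((hf.comp hφ h0).pair m) = 0)
    {φ : ℝ → ℝ} (hφ : ContDiff ℝ ∞ φ) (h0 : φ 0 = 0) (h1 : ∀ t, |deriv φ t| ≤ 1)
    (w : h10Pairs m B) : ∃ z : h10Pairs m B, N w z = 0 ∧ (z.1.1 =ᵐ[m] fun x => φ (w.1.1 x)) ∧
      z.1.2 =ᵐ[m] fun x => deriv φ (w.1.1 x) • w.1.2 x := by
  obtain ⟨f, hf, z, hw, hz, e₁, e₂⟩ := exists_comp_pair hφ h0 h1 w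
  refine ⟨z, tendsto_nhds_unique (IsGraphForm.tendsto_apply N hw hz) ?_, e₁, e₂⟩
  simp only [hN _ (hf _) φ hφ h0]
  exact tendsto_const_nhds

theorem right_self (hN : ∀ (f : Rn d → ℝ) (hf : IsTest B f) (φ : ℝ → ℝ)
      (hφ : ContDiff ℝ ∞ φ) (h0 : φ 0 = 0), N (hf.pair m) ((hf.comp hφ h0).pair m) = 0)
    (w : h10Pairs m B) : N w w = 0 := by
  obtain ⟨z, hz, e₁, e₂⟩ := right_comp_eq_zero hN (φ := id) contDiff_id rfl (by simp) w
  obtain rfl : z = w := Subtype.ext (Prod.ext (Lp.ext e₁)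
    (Lp.ext (e₂.trans (Eventually.of_forall fun x => by simp))))
  exact hz

/-- The unit contraction operates on `h10Pairs`, and `N(u, u⁺ ∧ 1) = 0`. -/
theorem exists_truncation (hN : ∀ (f : Rn d → ℝ) (hf : IsTest B f) (φ : ℝ → ℝ)
      (hφ : ContDiff ℝ ∞ φ) (h0 : φ 0 = 0), N (hf.pair m) ((hf.comp hφ h0).pair m) = 0)
    (w : h10Pairs m B) : ∃ z : h10Pairs m B, N w z = 0 ∧
      (z.1.1 =ᵐ[m] fun x => min (max (w.1.1 x) 0) 1) ∧
      z.1.2 =ᵐ[m] fun x => (Ioo (0 : ℝ) 1).indicator (1 : ℝ → ℝ) (w.1.1 x) • w.1.2 x := by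
  choose z hz e₁ e₂ using fun k => right_comp_eq_zero hN (contDiff_smoothTruncation k)
    (smoothTruncation_zero k) (by rw [deriv_smoothTruncation]; exact abs_cutoffDeriv_le k) w
  simp only [deriv_smoothTruncation] at e₂
  have hwm : AEStronglyMeasurable w.1.1 m := Lp.aestronglyMeasurable _
  have hm₁ : MemLp (fun x => min (max (w.1.1 x) 0) 1) 2 m := by
    refine (Lp.memLp w.1.1).of_le ((by fun_prop : Continuous fun t : ℝ =>
      min (max t 0) 1).comp_aestronglyMeasurable hwm) (Eventually.of_forall fun x => ?_)
    refine le_of_tendsto (tendsto_smoothTruncation _).abs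
      (Eventually.of_forall fun k => abs_smoothTruncation_le k _)
  have hχ : Measurable ((Ioo (0 : ℝ) 1).indicator (1 : ℝ → ℝ)) :=
    measurable_one.indicator measurableSet_Ioo
  have hm₂ : MemLp (fun x => (Ioo (0 : ℝ) 1).indicator (1 : ℝ → ℝ) (w.1.1 x) • w.1.2 x) 2 m := by
    refine (Lp.memLp w.1.2).of_le ((hχ.comp_aemeasurable hwm.aemeasurable).aestronglyMeasurable.smul
      (Lp.aestronglyMeasurable _)) (Eventually.of_forall fun x => ?_)
    rw [norm_smul]
    refine mul_le_of_le_one_left (norm_nonneg _) ?_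
    exact le_of_tendsto (tendsto_cutoffDeriv _).abs
      (Eventually.of_forall fun k => abs_cutoffDeriv_le k _)
  have l₁ : Tendsto (fun k => (z k).1.1) atTop (𝓝 (hm₁.toLp _)) := by
    rw [Lp.tendsto_Lp_iff_tendsto_eLpNorm']
    refine tendsto_eLpNorm_of_dominated (g := fun x => (2 : ℝ) • w.1.1 x)
      (fun k => (Lp.aestronglyMeasurable _).sub (Lp.aestronglyMeasurable _))
      ((Lp.memLp w.1.1).const_smul (2 : ℝ)) (fun k => ?_) ?_
    · filter_upwards [e₁ k, hm₁.coeFn_toLp] with x hx hx'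
      have h2 : |min (max (w.1.1 x) 0) 1| ≤ |w.1.1 x| := le_of_tendsto
        (tendsto_smoothTruncation _).abs
        (Eventually.of_forall fun k => abs_smoothTruncation_le k _)
      rw [Pi.sub_apply, hx, hx', norm_smul]
      refine (norm_sub_le _ _).trans ?_
      have := abs_smoothTruncation_le k (w.1.1 x)
      simp only [Real.norm_eq_abs, Nat.abs_ofNat] at *
      linarith
    · filter_upwards [ae_all_iff.2 e₁, hm₁.coeFn_toLp] with x hx hx'
      simp only [Pi.sub_apply, hx, hx']
      exact tendsto_sub_nhds_zero_iff.2 (tendsto_smoothTruncation _)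
  have l₂ : Tendsto (fun k => (z k).1.2) atTop (𝓝 (hm₂.toLp _)) :=
    tendsto_toLp_smul (c := fun k x => cutoffDeriv k (w.1.1 x)) (fun k x => abs_cutoffDeriv_le k _)
      (fun k => (contDiff_cutoffDeriv k).continuous.comp_aestronglyMeasurable hwm)
      (Eventually.of_forall fun x => tendsto_cutoffDeriv _) tendsto_const_nhds e₂ hm₂.coeFn_toLp
  have l := l₁.prodMk_nhds l₂
  refine ⟨⟨_, isClosed_h10Pairs.mem_of_tendsto l (Eventually.of_forall fun k => (z k).2)⟩,
    ?_, hm₁.coeFn_toLp, hm₂.coeFn_toLp⟩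
  refine tendsto_nhds_unique (IsGraphForm.tendsto_apply N (tendsto_const_nhds (x := w))
    (tendsto_subtype_rng.2 l)) ?_
  simp only [hz]
  exact tendsto_const_nhds

/-- The contraction property of the form `P - N`. -/
theorem exists_contraction (h : IsFormPair m B A b P N)
    (hN : ∀ (f : Rn d → ℝ) (hf : IsTest B f) (φ : ℝ → ℝ)
      (hφ : ContDiff ℝ ∞ φ) (h0 : φ 0 = 0), N (hf.pair m) ((hf.comp hφ h0).pair m) = 0)
    (hell : ∀ᵐ x ∂m, ∀ ξ : Rn d, 0 ≤ inner ℝ (matVec (A x) ξ) ξ) (w : h10Pairs m B) :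
    ∃ z : h10Pairs m B, (z.1.1 =ᵐ[m] fun x => min (max (w.1.1 x) 0) 1) ∧
      0 ≤ (bilinSub P N) (w + z) (w - z) ∧ 0 ≤ (bilinSub P N) (w - z) (w + z) := by
  obtain ⟨z, hz, e₁, e₂⟩ := exists_truncation hN w
  have hself := right_self hN
  -- Polarization: `N` vanishes on the diagonal, hence is antisymmetric.
  have hz' : N z w = 0 := by
    have := hself (w + z)
    simp only [map_add, _root_.add_apply, hself, hz] at this
    linarith
  have hχ : ∀ t : ℝ, 0 ≤ (Ioo (0 : ℝ) 1).indicator (1 : ℝ → ℝ) t ∧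
      (Ioo (0 : ℝ) 1).indicator (1 : ℝ → ℝ) t ≤ 1 := fun t =>
    ⟨indicator_nonneg (fun _ _ => zero_le_one) t, indicator_le_self' (fun _ _ => zero_le_one) t⟩
  have ha : (w + z).1.2 =ᵐ[m] fun x =>
      (1 + (Ioo (0 : ℝ) 1).indicator (1 : ℝ → ℝ) (w.1.1 x)) • w.1.2 x := by
    filter_upwards [e₂, Lp.coeFn_add w.1.2 z.1.2] with x hx hx'
    refine hx'.trans ?_
    rw [Pi.add_apply, hx, add_smul, one_smul]
  have hs : (w - z).1.2 =ᵐ[m] fun x =>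
      (1 - (Ioo (0 : ℝ) 1).indicator (1 : ℝ → ℝ) (w.1.1 x)) • w.1.2 x := by
    filter_upwards [e₂, Lp.coeFn_sub w.1.2 z.1.2] with x hx hx'
    refine hx'.trans ?_
    rw [Pi.sub_apply, hx, sub_smul, one_smul]
  have n₁ : N (w + z) (w - z) = 0 := by
    simp only [map_add, map_sub, _root_.add_apply, hself, hz, hz']
    simp
  have n₂ : N (w - z) (w + z) = 0 := by
    simp only [map_add, map_sub, _root_.sub_apply, hself, hz, hz']
    simp
  refine ⟨z, e₁, ?_, ?_⟩
  · rw [bilinSub_apply, n₁, sub_zero]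
    exact h.left_nonneg hell (fun x => by linarith [(hχ (w.1.1 x)).1])
      (fun x => by linarith [(hχ (w.1.1 x)).2]) ha hs
  · rw [bilinSub_apply, n₂, sub_zero]
    exact h.left_nonneg hell (fun x => by linarith [(hχ (w.1.1 x)).2])
      (fun x => by linarith [(hχ (w.1.1 x)).1]) hs ha

end IsFormPair

/-! ### Consequences of the hypotheses on the coefficients -/

theorem HypCoeff.aestronglyMeasurable (hyp : HypCoeff A H p) (i j : Fin d) :
    AEStronglyMeasurable (fun x => A x i j) volume :=
  (hyp.vmo i j).1.aestronglyMeasurable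

/-- On `B` both `ρ⁻¹` and `A` are bounded, so `ρ⁻¹ Aᵀ∇ρ` inherits `L^p` from `∇ρ`. Finite measure
and `d < p` then lower the exponent to `d`. -/
theorem memLp_driftB (hyp : HypCoeff A H p) (hρ : IsInvariantDensity A H p ρ Dρ)
    (hb : Bornology.IsBounded B) (hB : IsOpen B) :
    MemLp (driftB A H ρ Dρ) d ((refMeasure ρ).restrict B) := by
  rw [memLp_refMeasure_iff hρ.cont hρ.pos hb hB.measurableSet]
  have : IsFiniteMeasure ((volume : Measure (Rn d)).restrict B) := ⟨by
    simpa using hb.measure_lt_top⟩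
  obtain ⟨C, hC, hbd⟩ := exists_density_bounds hρ.cont hρ.pos hb
  obtain ⟨lam, M, -, hM, hA⟩ := hyp.elliptic_bounded
  refine MemLp.mono_exponent (q := ENNReal.ofReal p) ?_
    (by rw [← ENNReal.ofReal_natCast]; exact ENNReal.ofReal_le_ofReal hyp.lt_p.le)
  refine (hyp.drift B hB hb).sub ((hρ.memLpLoc_grad B hB hb).of_le_mul (c := C * (d * M)) ?_ ?_)
  · refine (hρ.cont.inv₀ fun x => (hρ.pos x).ne').aestronglyMeasurable.smul ?_
    exact aestronglyMeasurable_matVec (A := fun x => (A x)ᵀ)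
      (fun i j => (hyp.aestronglyMeasurable j i).restrict) (hρ.memLpLoc_grad B hB hb).1
  · filter_upwards [ae_restrict_of_ae hA, ae_restrict_mem hB.measurableSet] with x hx hxB
    rw [norm_smul, Real.norm_of_nonneg (inv_nonneg.2 (hρ.pos x).le), mul_assoc]
    gcongr
    · exact (hbd x hxB).2
    · exact norm_matVec_le hM.le (fun i j => hx.2 j i) _

/-- The vector field `ρ b` is divergence free: `∫ ⟨b, ∇f⟩ φ(f) dμ = 0`. -/
theorem setIntegral_driftB_comp (hρ : IsInvariantDensity A H p ρ Dρ) (hB : MeasurableSet B)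
    {f : Rn d → ℝ} (hf : IsTest B f) {φ : ℝ → ℝ} (hφ : ContDiff ℝ ∞ φ) :
    ∫ x in B, inner ℝ (driftB A H ρ Dρ x) (gradient f x) * φ (f x) ∂(refMeasure ρ) = 0 := by
  have hΦ : ∀ t, HasDerivAt (fun t => ∫ s in (0 : ℝ)..t, φ s) (φ t) t := fun t =>
    (hφ.continuous.integral_hasStrictDerivAt 0 t).hasDerivAt
  have hΦd : deriv (fun t => ∫ s in (0 : ℝ)..t, φ s) = φ := funext fun t => (hΦ t).deriv
  have hΦs : ContDiff ℝ ∞ fun t => ∫ s in (0 : ℝ)..t, φ s :=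
    contDiff_infty_iff_deriv.2 ⟨fun t => (hΦ t).differentiableAt, by rwa [hΦd]⟩
  -- The primitive starts at `0`, so composing it with `f` keeps the support in `B` and gives an
  -- admissible test function with gradient `φ(f) ∇f`.
  have h1 := hρ.invariant _ ((hf.mono (subset_univ B)).comp hΦs intervalIntegral.integral_same)
  have hg : ∀ x, gradient ((fun t => ∫ s in (0 : ℝ)..t, φ s) ∘ f) x = φ (f x) • gradient f x :=
    fun x => by
      rw [gradient_comp_real (hΦs.differentiable (by simp)) hf.differentiable, hΦd]
  -- The sign change is due to `Aᵀ∇ρ - ρ H = -ρ b`.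
  rw [setIntegral_refMeasure hρ.cont hρ.pos hB,
    setIntegral_eq_integral_of_forall_compl_eq_zero fun x hx => by simp [hf.gradient_eq_zero hx],
    ← neg_eq_zero, ← integral_neg, ← h1]
  refine integral_congr_ae (Eventually.of_forall fun x => ?_)
  simp only [hg, driftB, inner_sub_left, inner_smul_left, inner_smul_right, smul_eq_mul,
    map_inv₀, conj_trivial]
  field_simp [(hρ.pos x).ne']
  ring

/-- The form `P - N` computed with any versions of the functions and gradients. -/
theorem IsFormPair.energy_eq {μ : Measure (Rn d)} {b : Rn d → Rn d}
    {P N : h10Pairs (μ.restrict B) B →L[ℝ] h10Pairs (μ.restrict B) B →L[ℝ] ℝ}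
    (h : IsFormPair (μ.restrict B) B A b P N) {w z : h10Pairs (μ.restrict B) B}
    {F G : Rn d → Rn d} {g : Rn d → ℝ} (hF : w.1.2 =ᵐ[μ.restrict B] F)
    (hg : z.1.1 =ᵐ[μ.restrict B] g) (hG : z.1.2 =ᵐ[μ.restrict B] G) :
    EnergyIntegrable μ B A b F g G ∧ energy μ B A b F g G = (bilinSub P N) w z := by
  have e₁ : (fun x => inner ℝ (matVec (A x) (w.1.2 x)) (z.1.2 x)) =ᵐ[μ.restrict B]
      fun x => inner ℝ (matVec (A x) (F x)) (G x) := by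
    filter_upwards [hF, hG] with x h₁ h₂
    rw [h₁, h₂]
  have e₂ : (fun x => inner ℝ (b x) (w.1.2 x) * z.1.1 x) =ᵐ[μ.restrict B]
      fun x => inner ℝ (b x) (F x) * g x := by
    filter_upwards [hF, hg] with x h₁ h₂
    rw [h₁, h₂]
  refine ⟨⟨(h.integrable_left w z).congr e₁, (h.integrable_right w z).congr e₂⟩, ?_⟩
  rw [bilinSub_apply, h.left_eq, h.right_eq, energy,
    integral_congr_ae e₁, integral_congr_ae e₂]

theorem isCore_testForm (hc : Continuous ρ) (hpos : ∀ x, 0 < ρ x) (hb : Bornology.IsBounded B)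
    (hB : IsOpen B) {b : Rn d → Rn d} {P N : h10Pairs ((refMeasure ρ).restrict B) B →L[ℝ]
      h10Pairs ((refMeasure ρ).restrict B) B →L[ℝ] ℝ}
    (h : IsFormPair ((refMeasure ρ).restrict B) B A b P N) :
    IsGraphForm.IsCore (testForm (refMeasure ρ) B A b) (gradPairs ((refMeasure ρ).restrict B) B)
      (h10Pairs ((refMeasure ρ).restrict B) B) (bilinSub P N) := by
  have := isFiniteMeasure_refMeasure_restrict hc hpos hb hB.measurableSet
  refine ⟨rfl, le_antisymm ?_ ?_, fun w z hw hz => ?_⟩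
  · rintro u ⟨f, hf, hu⟩
    exact ⟨(hf.pair _).1, hf.pair_mem, Lp.ext (hf.pair_fst.trans hu.symm)⟩
  · rintro _ ⟨w, ⟨f, hf, hw, -⟩, rfl⟩
    exact ⟨f, hf, hw⟩
  · obtain ⟨f, hf, rfl⟩ := exists_eq_pair hw
    obtain ⟨g, hg, rfl⟩ := exists_eq_pair hz
    rw [← (h.energy_eq hf.pair_snd hg.pair_fst hg.pair_snd).2]
    simp only [testForm, testRep_eq hc hpos hB hf hf.pair_fst,
      testRep_eq hc hpos hB hg hg.pair_fst]
    rfl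

end Forms

end

/-! ### The main theorem. -/

set_option maxHeartbeats 1000000 in
theorem mainTheorem7 {d : ℕ} (A : Rn d → Matrix (Fin d) (Fin d) ℝ) (H : Rn d → Rn d) (p : ℝ)
    (hyp : HypCoeff A H p) (ρ : Rn d → ℝ) (Dρ : Rn d → Rn d)
    (hρ : IsInvariantDensity A H p ρ Dρ)
    (μ : Measure (Rn d)) (hμ : μ = refMeasure ρ)
    (b : Rn d → Rn d) (hb : b = driftB A H ρ Dρ)
    (x₀ : Rn d) (r : ℝ) (hr : 0 < r) (B : Set (Rn d)) (hB : B = Metric.ball x₀ r) :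
    -- the form is well defined and positive on test functions
    (∀ f g : Rn d → ℝ, IsTest B f → IsTest B g →
      EnergyIntegrable μ B A b (gradient f) g (gradient g)) ∧
    (∀ f : Rn d → ℝ, IsTest B f → 0 ≤ testEnergy μ B A b f f) ∧
    -- strong sector condition
    (∃ c : ℝ, 0 < c ∧ ∀ f g : Rn d → ℝ, IsTest B f → IsTest B g →
      |testEnergy μ B A b f g| ≤
        c * Real.sqrt (testEnergy μ B A b f f) * Real.sqrt (testEnergy μ B A b g g)) ∧
    -- closability, and properties of the closure
    (testForm μ B A b).IsClosable ∧
    ∃ E : DomForm (Lp ℝ 2 (μ.restrict B)),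
      E.IsClosureOf (testForm μ B A b) ∧
      E.IsSmallestCoerciveClosedExtension (testForm μ B A b) ∧
      -- the domain is `H₀^{1,2}(B)`, as a space of functions modulo a.e. equality
      (∀ u : Rn d → ℝ, (∃ hu : MemLp u 2 (μ.restrict B), hu.toLp u ∈ E.dom) ↔ MemH10 B u) ∧
      -- the representation of the closure through weak gradients
      (∀ u ∈ E.dom, ∀ v ∈ E.dom, ∀ Du Dv : Rn d → Rn d,
        HasWeakGradient B u Du → HasWeakGradient B v Dv →
          EnergyIntegrable μ B A b Du v Dv ∧ E.form u v = energy μ B A b Du v Dv) ∧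
      (∀ u ∈ E.dom, ∀ Du : Rn d → Rn d, HasWeakGradient B u Du →
        E.form u u = ∫ x in B, inner ℝ (matVec (A x) (Du x)) (Du x) ∂μ) ∧
      E.IsDirichlet := by
  subst hμ hb
  have hBo : IsOpen B := hB ▸ Metric.isOpen_ball
  have hBb : Bornology.IsBounded B := hB ▸ Metric.isBounded_ball
  have hc := hρ.cont
  have hpos := hρ.pos
  have hfin := isFiniteMeasure_refMeasure_restrict hc hpos hBb hBo.measurableSet
  have hae := ae_refMeasure_eq hc hpos hBb hBo.measurableSet
  obtain ⟨lam, M, hlam, hM, hA⟩ := hyp.elliptic_bounded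
  have hA' : ∀ᵐ x ∂(refMeasure ρ).restrict B,
      (∀ ξ : Rn d, lam * ‖ξ‖ ^ 2 ≤ inner ℝ (matVec (A x) ξ) ξ) ∧ ∀ i j, |A x i j| ≤ M := by
    rw [hae]
    exact ae_restrict_of_ae hA
  have hell := hA'.mono fun x hx => hx.1
  have hell0 : ∀ᵐ x ∂(refMeasure ρ).restrict B, ∀ ξ : Rn d, 0 ≤ inner ℝ (matVec (A x) ξ) ξ :=
    hell.mono fun x hx ξ => le_trans (by positivity) (hx ξ)
  have hbL := memLp_driftB hyp hρ hBb hBo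
  obtain ⟨C, hC, hbd⟩ := exists_drift_bound hyp.three_le hc hpos hBb hBo hbL
  have hac : (refMeasure ρ).restrict B ≪ volume.restrict B :=
    Measure.ae_le_iff_absolutelyContinuous.1 hae.le
  obtain ⟨P, N, hPN⟩ := exists_isFormPair
    (fun i j => (hyp.aestronglyMeasurable i j).restrict.mono_ac hac) hM.le
    (hA'.mono fun x hx => hx.2) hbL.1 hC hbd
  have hN : ∀ (f : Rn d → ℝ) (hf : IsTest B f) (φ : ℝ → ℝ) (hφ : ContDiff ℝ ∞ φ) (h0 : φ 0 = 0),
      N (hf.pair _) ((hf.comp hφ h0).pair _) = 0 := fun f hf φ hφ h0 => by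
    rw [hPN.right_eq, ← setIntegral_driftB_comp hρ hBo.measurableSet hf hφ]
    refine integral_congr_ae ?_
    filter_upwards [hf.pair_snd (m := (refMeasure ρ).restrict B),
      (hf.comp hφ h0).pair_fst (m := (refMeasure ρ).restrict B)] with x e₁ e₂
    rw [e₁, e₂]
    rfl
  have hNs := IsFormPair.right_self hN
  -- The drift is invisible on the diagonal, so the ellipticity constant `lam` serves directly as
  -- the coercivity constant.
  have hself : ∀ w, (bilinSub P N) w w = P w w := fun w => by
    rw [bilinSub_apply, hNs, sub_zero]
  have hG : IsGraphForm (h10Pairs ((refMeasure ρ).restrict B) B) (bilinSub P N) :=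
    ⟨h10Pairs_graph hc hpos hBb hBo, hPN.bound, lam, hlam, fun w => by
      rw [hself]
      exact hPN.coercive hell w⟩
  have hcore := isCore_testForm hc hpos hBb hBo hPN
  have htest : ∀ f g (hf : IsTest B f) (hg : IsTest B g),
      testEnergy (refMeasure ρ) B A (driftB A H ρ Dρ) f g =
        bilinSub P N (hf.pair _) (hg.pair _) :=
    fun f g hf hg => (hPN.energy_eq hf.pair_snd hg.pair_fst hg.pair_snd).2
  have hdense :
      Dense ((graphForm _ (bilinSub P N)).dom : Set (Lp ℝ 2 ((refMeasure ρ).restrict B))) :=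
    (dense_testSubmodule hc hpos hBb hBo).mono (hcore.extends_graphForm hG).1
  have hcoer := hG.isCoerciveClosed isClosed_h10Pairs hdense
  have hclos := hcore.isClosureOf hG
  -- Uniqueness of weak gradients makes the representation valid for every version `D`, not only for
  -- the one stored in the pair.
  have hgrad : ∀ (w : h10Pairs ((refMeasure ρ).restrict B) B) (D : Rn d → Rn d),
      HasWeakGradient B w.1.1 D → w.1.2 =ᵐ[(refMeasure ρ).restrict B] D := fun w D hD => by
    rw [EventuallyEq, hae]
    exact (hasWeakGradient_of_h10Pairs hc hpos hBb hBo w).ae_eq hBo hD (EventuallyEq.refl _ _)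
  refine ⟨fun f g hf hg => (hPN.energy_eq hf.pair_snd hg.pair_fst hg.pair_snd).1,
    fun f hf => ?_, ?_, hcore.isClosable hG, graphForm _ (bilinSub P N), hclos,
    hclos.isSmallest hcoer (hcore.extends_graphForm hG), fun u => ?_, ?_, ?_, hcoer, ?_⟩
  · rw [htest f f hf hf]
    exact hG.nonneg _
  · obtain ⟨c, hc0, hs⟩ := hG.strongSector
    refine ⟨c, hc0, fun f g hf hg => ?_⟩
    rw [htest f g hf hg, htest f f hf hf, htest g g hg hg]
    exact hs _ _
  · rw [memH10_iff hc hpos hBb hBo]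
    constructor
    · rintro ⟨hu, hmem⟩
      obtain ⟨w, hw⟩ := IsGraphForm.mem_dom.1 hmem
      exact ⟨w, by rw [hw]; exact hu.coeFn_toLp⟩
    · rintro ⟨w, hw⟩
      have hu : MemLp u 2 ((refMeasure ρ).restrict B) := (memLp_congr_ae hw).1 (Lp.memLp _)
      exact ⟨hu, IsGraphForm.mem_dom.2 ⟨w, Lp.ext (hw.trans hu.coeFn_toLp.symm)⟩⟩
  · intro u hu v hv Du Dv hDu hDv
    obtain ⟨w, rfl⟩ := IsGraphForm.mem_dom.1 hu
    obtain ⟨z, rfl⟩ := IsGraphForm.mem_dom.1 hv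
    obtain ⟨h₁, h₂⟩ := hPN.energy_eq (hgrad w Du hDu) (EventuallyEq.refl _ _) (hgrad z Dv hDv)
    exact ⟨h₁, by rw [h₂, hG.form_eq]⟩
  · intro u hu Du hDu
    obtain ⟨w, rfl⟩ := IsGraphForm.mem_dom.1 hu
    rw [hG.form_eq, hself, hPN.left_eq]
    refine integral_congr_ae ?_
    filter_upwards [hgrad w Du hDu] with x hx
    rw [hx]
  · intro u hu
    obtain ⟨w, rfl⟩ := IsGraphForm.mem_dom.1 hu
    obtain ⟨z, hz, h₁, h₂⟩ := hPN.exists_contraction hN hell0 w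
    rw [← hG.form_add_sub] at h₁
    rw [← hG.form_sub_add] at h₂
    exact ⟨z.1.1, IsGraphForm.mem_dom.2 ⟨z, rfl⟩, hz, h₁, h₂⟩
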